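/- Let $l\ge 0$ and let $M^l$ be the rank $l$ Heisenberg vertex operator algebra over $\mathbb C$, with basis the Fock vectors $a^{i_1}(-k_1)\cdots a^{i_r}(-k_r)\mathbf 1$ ($k_j>0$), modes satisfying $[a^i(n),a^j(m)]=n\,\delta_{n,-m}\delta_{i,j}$, vacuum $\mathbf 1$ and conformal vector $\omega=\frac12\sum_{i=1}^l a^i(-1)^2\mathbf 1$. For $\alpha\in\mathbb C^l$ let $M_\alpha=M^l\otimes e^\alpha$ be the $M^l$-module on which $a^i(0)$ acts as the scalar $\alpha^i$ and $a^i(n)(u\otimes e^\alpha)=(a^i(n)u)\otimes e^\alpha$ for $n\ne0$; so $M_0=M^l$. Write $Y$ and $Y_{M_\alpha}$ for the vertex operators of $M^l$ and $M_\alpha$, and $L_{M_\alpha}(-1)$ for the coefficient of $z^{-1}$ in $Y_{M_\alpha}(\omega,z)$. A creative intertwiner for $M_\alpha$ is a linear map $w\mapsto\mathcal Y(w,z)=\sum_{n\in\mathbb Z}w(n)z^{-n-1}$ from $M_\alpha$ to $\mathrm{Lin}(M^l,M_\alpha)[[z,z^{-1}]]$ such that, for all $w\in M_\alpha$ and $u,v\in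 M^l$: $\mathcal Y(w,z)\mathbf 1=w+O(z)$; $w(n)v=0$ for $n\gg0$; $\mathcal Y(L_{M_\alpha}(-1)w,z)=\partial_z\mathcal Y(w,z)$; and the Jacobi identity $$z_0^{-1}\delta\Big(\frac{z_1-z_2}{z_0}\Big)Y_{M_\alpha}(u,z_1)\mathcal Y(w,z_2)-z_0^{-1}\delta\Big(\frac{z_2-z_1}{-z_0}\Big)\mathcal Y(w,z_2)Y(u,z_1)=z_2^{-1}\delta\Big(\frac{z_1-z_0}{z_2}\Big)\mathcal Y(Y_{M_\alpha}(u,z_0)w,z_2)$$ holds, where $\delta(x)=\sum_{n\in\mathbb Z}x^n$ and $(x-y)^n$ is expanded in nonnegative powers of $y$. Put $\alpha(n)=\sum_{i=1}^l\alpha^i a^i(n)$ and $Y_\pm(\alpha,z)=\exp\big(\mp\sum_{n>0}\frac{\alpha(\pm n)}{n}z^{\mp n}\big)$, let $e^{\alpha\cdot q}:M^l\to M_\alpha$ be the map $u\mapsto u\otimes e^\alpha$, and let $z^{\alpha(0)}$ act on a vector with $\alpha(0)$-eigenvalue $\lambda$ as multiplication by $z^\lambda$. Theorem. For every $\alpha\in\mathbb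 C^l$ there is exactly one creative intertwiner $\mathcal Y$ for $M_\alpha$, and for all $u\in M^l$ it is given, as a series of linear maps $M^l\to M_\alpha$, by $$\mathcal Y(u\otimes e^\alpha,z)=e^{\alpha\cdot q}\,c_\alpha\,Y_-(\alpha,z)\,Y(u,z)\,Y_+(\alpha,z)\,z^{\alpha(0)},\qquad c_\alpha=\mathrm{Id}_{M^l}.$$ -/

import Mathlib

noncomputable section

/-! ### Creative intertwiners

A vertex operator `Y(u,z) = ∑ u(n) z^{-n-1}` is given by its modes: `Y u n` is `u(n)`. -/

/-- `𝒴` is a creative intertwining vertex operator for the module `(W, YW)` over `(V, Y, vac, ω)`;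
the mode `w(n) : V → W` is `𝒴 w n`.

* `creative`: `𝒴(w,z) vac = w + O(z)`.
* `truncated`: `w(n) v = 0` for `n` large.
* `translation`: `𝒴(L_W(-1) w, z) = ∂_z 𝒴(w,z)`, where `L_W(-1)` is the mode `ω_W(0)`.
* `jacobi`: the coefficient of `z₀^{-r-1} z₁^{-p-1} z₂^{-q-1}` in
  `z₀⁻¹ δ((z₁-z₂)/z₀) Y_W(u,z₁) 𝒴(w,z₂) - z₀⁻¹ δ((z₂-z₁)/(-z₀)) 𝒴(w,z₂) Y(u,z₁)
    = z₂⁻¹ δ((z₁-z₀)/z₂) 𝒴(Y_W(u,z₀) w, z₂)`, applied to `v`, where `(x-y)^n` is expanded in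
  nonnegative powers of `y`. All three sums are finite when `Y`, `YW`, `𝒴` are lower truncated. -/
structure IsCreativeIntertwiner {V W : Type*} [AddCommGroup V] [Module ℂ V]
    [AddCommGroup W] [Module ℂ W]
    (Y : V →ₗ[ℂ] (ℤ → Module.End ℂ V)) (vac ω : V)
    (YW : V →ₗ[ℂ] (ℤ → Module.End ℂ W))
    (𝒴 : W →ₗ[ℂ] (ℤ → (V →ₗ[ℂ] W))) : Prop where
  creative : ∀ w : W, 𝒴 w (-1) vac = w ∧ ∀ n : ℤ, 0 ≤ n → 𝒴 w n vac = 0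
  truncated : ∀ (w : W) (v : V), ∃ N : ℤ, ∀ n : ℤ, N ≤ n → 𝒴 w n v = 0
  translation : ∀ (w : W) (n : ℤ), 𝒴 (YW ω 0 w) n = (-n) • 𝒴 w (n - 1)
  jacobi : ∀ (u : V) (w : W) (v : V) (p q r : ℤ),
    (∑ᶠ j : ℕ, ((-1) ^ j * Ring.choose r j : ℤ) • YW u (p + r - j) (𝒴 w (q + j) v))
      - (∑ᶠ j : ℕ, ((r.negOnePow : ℤ) * (-1) ^ j * Ring.choose r j : ℤ) •
          𝒴 w (q + r - j) (Y u (p + j) v))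
      = ∑ᶠ j : ℕ, ((-1) ^ j * Ring.choose ((j : ℤ) - p - 1) j : ℤ) •
          𝒴 (YW u (r + j) w) (p + q - j) v

/-- The series `∑ₙ x(n) z^{-n-1}` as a formal series with complex exponents (the value at `s` is
the coefficient of `z^s`). -/
def modeSeries {W : Type*} [AddCommGroup W] (x : ℤ → W) : ℂ → W :=
  fun s => ∑ᶠ (n : ℤ) (_ : s = -(n : ℂ) - 1), x n

namespace Heisenberg

/-! ### The Fock space and the Heisenberg modes -/

/-- The Fock space `M^l`: the monomial `∏ X (iⱼ, kⱼ)` is the Fock vector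
`∏ a^{iⱼ}(-kⱼ-1) 𝟏`, and `1` is the vacuum. -/
abbrev Fock (l : ℕ) : Type := MvPolynomial (Fin l × ℕ) ℂ

/-- `M_β = M^l ⊗ e^β`, realised on the space `M^l`: the vector `u` stands for `u ⊗ e^β`. The
dependence on `β` is in the zero modes, see `mode`. In particular `M_0` is `M^l`. -/
abbrev FockModule {l : ℕ} (_β : Fin l → ℂ) : Type := Fock l

variable {l : ℕ}

/-- The conformal vector `ω = ½ ∑ᵢ a^i(-1)² 𝟏`. -/
def conformal (l : ℕ) : Fock l :=
  (1 / 2 : ℂ) • ∑ i : Fin l, (MvPolynomial.X (i, 0)) ^ 2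

/-- The Heisenberg mode `a^i(n)` on `M_β`. -/
def mode (β : Fin l → ℂ) (i : Fin l) : ℤ → Module.End ℂ (FockModule β)
  | Int.negSucc k => LinearMap.mulLeft ℂ (MvPolynomial.X (i, k))
  | Int.ofNat 0 => β i • LinearMap.id
  | Int.ofNat (k + 1) => ((k : ℂ) + 1) • (MvPolynomial.pderiv (i, k)).toLinearMap

/-- `α(n) = ∑ᵢ α^i a^i(n)` on `M_β`. -/
def alphaMode (β α : Fin l → ℂ) (n : ℤ) : Module.End ℂ (FockModule β) :=
  ∑ i, α i • mode β i n

theorem mode_comm (β : Fin l → ℂ) (i j : Fin l) (n m : ℕ) (v : FockModule β) :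
    mode β i n (mode β j m v) = mode β j m (mode β i n v) := by
  rcases n with _ | n <;> rcases m with _ | m
  · change β i • (β j • v) = β j • (β i • v)
    exact smul_comm _ _ _
  · change β i • (((m : ℂ) + 1) • MvPolynomial.pderiv (j, m) v) =
      ((m : ℂ) + 1) • MvPolynomial.pderiv (j, m) (β i • v)
    rw [Derivation.map_smul, smul_comm]
  · change ((n : ℂ) + 1) • MvPolynomial.pderiv (i, n) (β j • v) =
      β j • (((n : ℂ) + 1) • MvPolynomial.pderiv (i, n) v)
    rw [Derivation.map_smul, smul_comm]
  · change ((n : ℂ) + 1) • MvPolynomial.pderiv (i, n) (((m : ℂ) + 1) •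
        MvPolynomial.pderiv (j, m) v) =
      ((m : ℂ) + 1) • MvPolynomial.pderiv (j, m) (((n : ℂ) + 1) •
        MvPolynomial.pderiv (i, n) v)
    rw [Derivation.map_smul, Derivation.map_smul, smul_comm]
    have h : ⁅MvPolynomial.pderiv (R := ℂ) (i, n), MvPolynomial.pderiv (R := ℂ) (j, m)⁆ = 0 := by
      apply MvPolynomial.derivation_ext
      intro x
      rw [Derivation.commutator_apply, MvPolynomial.pderiv_X, MvPolynomial.pderiv_X,
        Pi.single_apply, Pi.single_apply]
      split_ifs <;> simp
    have h' := congrArg (fun D => D v) h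
    simp only [Derivation.commutator_apply, Derivation.zero_apply, sub_eq_zero] at h'
    rw [h']

theorem exists_mode_eq_zero (β : Fin l → ℂ) (v : FockModule β) :
    ∃ N : ℕ, ∀ (i : Fin l) (n : ℕ), N ≤ n → mode β i n v = 0 := by
  refine ⟨(v.vars.sup Prod.snd) + 2, fun i n hn => ?_⟩
  obtain ⟨k, rfl⟩ : ∃ k, n = k + 1 := ⟨n - 1, by omega⟩
  change ((k : ℂ) + 1) • MvPolynomial.pderiv (i, k) v = 0
  rw [MvPolynomial.pderiv_eq_zero_of_notMem_vars, smul_zero]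
  intro h
  have := Finset.le_sup (f := Prod.snd) h
  simp only at this
  omega

/-! ### Vertex operators of the Heisenberg algebra -/

/-- A field on the Fock space: a linear map `A(z) : M → M((z))`. -/
abbrev FockField (l : ℕ) : Type := Fock l →ₗ[ℂ] LaurentSeries (Fock l)

/-- The part `∑_{n<0} a^i(n) (1/k!) ∂_z^k z^{-n-1}` of `(1/k!) ∂_z^k a^i(z)`; since `a^i(-m-1)` is
multiplication by `X (i, m)`, this is multiplication by a power series over `M`. -/
def creationPart (x : Fin l × ℕ) : LaurentSeries (Fock l) :=
  HahnSeries.ofPowerSeries ℤ (Fock l)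
    (PowerSeries.mk fun j => ((j + x.2).choose x.2 : Fock l) * MvPolynomial.X (x.1, j + x.2))

/-- The scalar `(1/k!) ∂_z^k z^{-n-1}`. -/
def annihilationCoeff (k n : ℕ) : LaurentSeries (Fock l) :=
  HahnSeries.single (-(n : ℤ) - 1 - k) ((Ring.choose (-(n : ℤ) - 1) k : ℤ) : Fock l)

theorem normalMul_finite (β : Fin l → ℂ) (i : Fin l) (k : ℕ) (A : FockField l)
    (v : FockModule β) :
    (Function.support fun n : ℕ => annihilationCoeff k n * A (mode β i n v)).Finite := by
  obtain ⟨N, hN⟩ := exists_mode_eq_zero β v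
  refine (Finset.range N).finite_toSet.subset fun n hn => ?_
  by_contra h
  simp only [Finset.coe_range, Set.mem_Iio, not_lt] at h
  exact hn (by simp [hN i n h])

/-- The normally ordered product `:((1/k!) ∂_z^k a^i(z)) A(z):` on `M_β`, with `x = (i, k)`: the
modes `a^i(n)`, `n < 0`, stand to the left of `A(z)`, and the modes with `n ≥ 0` to the right. -/
def normalMul (β : Fin l → ℂ) (x : Fin l × ℕ) (A : FockField l) : FockField l where
  toFun v := creationPart x * A v + ∑ᶠ n : ℕ, annihilationCoeff x.2 n * A (mode β x.1 n v)
  map_add' v w := by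
    simp only [map_add, mul_add]
    rw [finsum_add_distrib (normalMul_finite β x.1 x.2 A v) (normalMul_finite β x.1 x.2 A w)]
    abel
  map_smul' c v := by
    have h : ∀ a b : LaurentSeries (Fock l), a * c • b = c • (a * b) := by
      have hc : ∀ b : LaurentSeries (Fock l), c • b = HahnSeries.C (MvPolynomial.C c) * b := by
        intro b
        ext1
        funext n
        rw [HahnSeries.C_mul_eq_smul, HahnSeries.coeff_smul, HahnSeries.coeff_smul,
          MvPolynomial.smul_eq_C_mul, smul_eq_mul]
      intro a b
      rw [hc, hc, mul_left_comm]
    simp only [map_smul, h, RingHom.id_apply, smul_add]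
    rw [smul_finsum' c (normalMul_finite β x.1 x.2 A v)]

theorem normalMul_eq_sum (β : Fin l → ℂ) (x : Fin l × ℕ) (A : FockField l) (v : Fock l)
    (N : ℕ) (hN : ∀ n : ℕ, N ≤ n → mode β x.1 n v = 0) :
    normalMul β x A v = creationPart x * A v +
      ∑ n ∈ Finset.range N, annihilationCoeff x.2 n * A (mode β x.1 n v) := by
  change creationPart x * A v + ∑ᶠ n : ℕ, annihilationCoeff x.2 n * A (mode β x.1 n v) = _
  rw [finsum_eq_sum_of_support_subset]
  intro n hn
  by_contra h
  simp only [Finset.coe_range, Set.mem_Iio, not_lt] at h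
  exact hn (by simp [hN n h])

/-- Normally ordered multiplications by derivatives of the `a^i(z)` commute, so that iterated
normally ordered products do not depend on the order of the factors. -/
instance normalMul_leftCommutative (β : Fin l → ℂ) :
    LeftCommutative (normalMul β) where
  left_comm x y A := by
    refine LinearMap.ext fun v => ?_
    obtain ⟨N, hN⟩ := exists_mode_eq_zero β v
    have h2 : ∀ (i j : Fin l) (m n : ℕ), N ≤ n → mode β i n (mode β j m v) = 0 := by
      intro i j m n hn
      rw [mode_comm, hN i n hn, map_zero]
    have key : ∀ x y : Fin l × ℕ, normalMul β x (normalMul β y A) v =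
        creationPart x * creationPart y * A v +
        (∑ n ∈ Finset.range N, creationPart x * annihilationCoeff y.2 n * A (mode β y.1 n v)) +
        ((∑ n ∈ Finset.range N, creationPart y * annihilationCoeff x.2 n * A (mode β x.1 n v)) +
        ∑ n ∈ Finset.range N, ∑ m ∈ Finset.range N,
          annihilationCoeff x.2 n * annihilationCoeff y.2 m *
            A (mode β y.1 m (mode β x.1 n v))) := by
      intro x y
      rw [normalMul_eq_sum β x _ v N (hN x.1), normalMul_eq_sum β y _ v N (hN y.1), mul_add,
        Finset.mul_sum, ← Finset.sum_add_distrib]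
      congr 1
      · simp only [mul_assoc]
      · refine Finset.sum_congr rfl fun n _ => ?_
        rw [normalMul_eq_sum β y _ _ N (h2 y.1 x.1 n), mul_add, Finset.mul_sum]
        congr 1
        · ring
        · simp only [mul_assoc]
    rw [key x y, key y x, Finset.sum_comm, mul_comm (creationPart x) (creationPart y)]
    have : ∀ m n : ℕ, annihilationCoeff (l := l) x.2 n * annihilationCoeff y.2 m *
            A (mode β y.1 m (mode β x.1 n v)) =
        annihilationCoeff y.2 m * annihilationCoeff x.2 n *
            A (mode β x.1 n (mode β y.1 m v)) := by
      intro m n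
      rw [mode_comm, mul_comm (annihilationCoeff x.2 n)]
    simp only [this]
    abel

/-- The module vertex operator `Y_{M_β}(u,z)`, linear in `u`: for a Fock vector
`u = ∏ a^{iⱼ}(-kⱼ-1) 𝟏` it is the normally ordered product of the `(1/kⱼ!) ∂_z^{kⱼ} a^{iⱼ}(z)`. -/
def vertexField (β : Fin l → ℂ) : Fock l →ₗ[ℂ] FockField l :=
  (MvPolynomial.basisMonomials (Fin l × ℕ) ℂ).constr ℂ fun m =>
    (Finsupp.toMultiset m).foldr (normalMul β)
      { toFun := fun v => HahnSeries.single 0 v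
        map_add' := fun v w => by simp
        map_smul' := fun c v => by
          ext n
          by_cases h : n = 0 <;> simp [h] }

/-- The modes of `Y_{M_β}(u,z) = ∑ u(n) z^{-n-1}`. For `β = 0` these are the vertex operators of
the Heisenberg vertex operator algebra `M^l` itself. -/
def vertexModes (β : Fin l → ℂ) : Fock l →ₗ[ℂ] (ℤ → Module.End ℂ (FockModule β)) where
  toFun u n :=
    { toFun := fun v => (vertexField β u v).coeff (-n - 1)
      map_add' := fun v w => by simp
      map_smul' := fun c v => by simp }
  map_add' u w := funext fun n => LinearMap.ext fun v => by simp
  map_smul' c u := funext fun n => LinearMap.ext fun v => by simp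

/-! ### The explicit operator -/

/-- `exp(S)` for an operator-valued power series `S` without constant term. -/
def opExp (S : PowerSeries (Module.End ℂ (Fock l))) : PowerSeries (Module.End ℂ (Fock l)) :=
  PowerSeries.mk fun n =>
    ∑ k ∈ Finset.range (n + 1), ((k.factorial : ℂ)⁻¹) • PowerSeries.coeff n (S ^ k)

/-- `Y_-(α,z) = exp(∑_{n>0} α(-n)/n z^n)` on `M_β`, a power series in `z`. -/
def expMinus (β α : Fin l → ℂ) : PowerSeries (Module.End ℂ (FockModule β)) :=
  opExp (PowerSeries.mk fun n => if n = 0 then 0 else ((n : ℂ)⁻¹) • alphaMode β α (-(n : ℤ)))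

/-- `Y_+(α,z) = exp(-∑_{n>0} α(n)/n z^{-n})` on `M_β`, a power series in `z⁻¹`. -/
def expPlus (β α : Fin l → ℂ) : PowerSeries (Module.End ℂ (FockModule β)) :=
  opExp (PowerSeries.mk fun n => if n = 0 then 0 else (-(n : ℂ)⁻¹) • alphaMode β α (n : ℤ))

/-- `z^{α(0)}` on `M_β`, with values in finite sums of complex powers of `z`: `α(0)` acts on `M_β`
as the scalar `α·β`. -/
def zPow (β α : Fin l → ℂ) : FockModule β →ₗ[ℂ] (ℂ →₀ FockModule β) :=
  Finsupp.lsingle (∑ i, α i * β i)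

/-- `e^{α·q} : M^l → M_α`, `u ↦ u ⊗ e^α`. -/
def expQ (α : Fin l → ℂ) : Fock l ≃ₗ[ℂ] FockModule α := LinearEquiv.refl ℂ _

/-- The coefficient of `z^t` in `Y_-(α,z) Y(u,z) Y_+(α,z) v`, for `v ∈ M^l`: the sum over the
exponents `m` of `z` from `Y_-` and `-p` from `Y_+`, of which only finitely many contribute. -/
def dressedCoeff (α : Fin l → ℂ) (u : Fock l) (t : ℤ) (v : Fock l) : Fock l :=
  ∑ᶠ mp : ℕ × ℕ, PowerSeries.coeff mp.1 (expMinus 0 α)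
    ((vertexField 0 u (PowerSeries.coeff mp.2 (expPlus 0 α) v)).coeff (t - mp.1 + mp.2))

/-- The series `e^{α·q} c Y_-(α,z) Y(u,z) Y_+(α,z) z^{α(0)} v`, for `v ∈ M^l`, as a formal series
with complex exponents and coefficients in `M_α`; `c` is a `z`-independent operator on `M^l`. -/
def explicitSeries (α : Fin l → ℂ) (c : Module.End ℂ (Fock l)) (u v : Fock l) :
    ℂ → FockModule α :=
  fun s => (zPow 0 α v).sum fun e w =>
    ∑ᶠ (t : ℤ) (_ : (t : ℂ) + e = s), expQ α (c (dressedCoeff α u t w))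

end Heisenberg

end

open Finset Filter

/-! ### Binomial coefficients and finite sums -/

/-! Existence. Let $E(z)=Y_-(\alpha,z)Y_+(\alpha,z)$ (`expField`). Since $Y_-$ commutes with the
creation modes and $Y_+$ with the modes $a^i(n)$, $n\ge 0$, dressing by $Y_\pm$ commutes with
normally ordered multiplication by derivatives of the $a^i(z)$. So $Y_-Y(u,z)Y_+$ is the same
iterated normally ordered product as $Y(u,z)$, with the identity field replaced by $E$
(`dress_fieldOf`). The vertex operators and the candidate intertwiner are therefore all instances of
`fieldOf`, and their properties only need to be checked on the seed field. For $E$ these are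
$[a^i(n),E]=\alpha^i z^nE$ (`ad_mode_expField`), $[L(-1),E]=\partial_zE$ (`ad_transl_expField`) and
$\partial_zE={:}\alpha(z)E{:}$ (`fieldDeriv_expField`). They propagate to the commutator formula
with the Heisenberg modes, to translation covariance and to the translation axiom. The factor
$z^{\alpha(0)}$ is the identity on $M^l$.

Jacobi identity. The difference $D(u,w,v;p,q,r)$ of the two sides obeys a commutator formula under
$a^i(n)$ (`jacobiDefect_covariant`), so it vanishes for all $v$ once it vanishes for $v=\mathbf 1$.
On the vacuum, multiplication by $z_1-z_2$ raises $r$, and $L(-1)$ acts as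
$\partial_{z_1}+\partial_{z_2}$. Creativity gives $D=0$ for $p\ge0$, $q\ge-1$; skew symmetry gives
$p=-1$, $q=0$; the two recursions reach all remaining indices.

Uniqueness. Creativity and the translation axiom determine $\mathcal Y(w,z)\mathbf 1$. The Jacobi
identity for $u=a^i(-1)\mathbf 1$ contains the commutator formula, which determines $\mathcal
Y(w,z)$ on every vector created from $\mathbf 1$. -/

theorem Ring.choose_succ_mul (n : ℤ) (k : ℕ) :
    ((k : ℤ) + 1) * Ring.choose n (k + 1) = n * Ring.choose (n - 1) k := by
  have h := Ring.choose_smul_choose n (n := k + 1) (k := 1) (by omega)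
  simpa [Ring.choose_one_right] using h

theorem Ring.sub_mul_choose (n : ℤ) (k : ℕ) :
    (n - k) * Ring.choose n k = n * Ring.choose (n - 1) k := by
  have h1 := Ring.choose_succ_mul n k
  have h2 := Ring.choose_smul_choose n (n := k + 1) (k := k) (by omega)
  have h3 : k + 1 - k = 1 := by omega
  rw [h3, Ring.choose_one_right, Nat.choose_succ_self_right, nsmul_eq_mul] at h2
  push_cast at h2
  linarith

theorem Ring.choose_mul_choose (n : ℤ) (i k : ℕ) :
    Ring.choose n (k + i) * ((k + i).choose k : ℤ) = Ring.choose n k * Ring.choose (n - k) i := by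
  have h := Ring.choose_smul_choose n (n := k + i) (k := k) (by omega)
  rw [nsmul_eq_mul, Nat.add_sub_cancel_left] at h
  rw [← h, mul_comm]

/-- Upper negation. It turns the coefficients of the iterate side in `IsCreativeIntertwiner.jacobi`
into plain binomials. -/
theorem Ring.neg_one_pow_mul_choose (p : ℤ) (j : ℕ) :
    (-1) ^ j * Ring.choose ((j : ℤ) - p - 1) j = Ring.choose p j := by
  have h := Ring.choose_neg (-p) j
  rw [neg_neg] at h
  rw [h, show -p + (j : ℤ) - 1 = j - p - 1 by ring, Units.smul_def, smul_eq_mul]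
  congr 1

theorem Ring.choose_int_nat_eq_zero {p : ℤ} (hp : 0 ≤ p) {j : ℕ} (h : p < j) :
    Ring.choose p j = 0 := by
  lift p to ℕ using hp
  rw [Ring.choose_natCast, Nat.choose_eq_zero_of_lt (by omega), Nat.cast_zero]

section Sums

variable {M : Type*} [AddCommMonoid M]

theorem finsum_eq_sum_range {f : ℕ → M} {N : ℕ} (h : ∀ j, N ≤ j → f j = 0) :
    ∑ᶠ j, f j = ∑ j ∈ range N, f j := by
  refine finsum_eq_sum_of_support_subset _ fun n hn => ?_
  by_contra h'
  simp only [coe_range, Set.mem_Iio, not_lt] at h'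
  exact hn (h n h')

theorem sum_range_eq_sum_range {f : ℕ → M} {K N : ℕ} (hK : ∀ j, K ≤ j → f j = 0)
    (hN : ∀ j, N ≤ j → f j = 0) : ∑ j ∈ range K, f j = ∑ j ∈ range N, f j := by
  rw [← finsum_eq_sum_range hK, finsum_eq_sum_range hN]

theorem sum_range_range_antidiagonal (f : ℕ → ℕ → M) (N : ℕ)
    (h : ∀ i j, N ≤ i + j → f i j = 0) :
    ∑ i ∈ range N, ∑ j ∈ range N, f i j =
      ∑ J ∈ range N, ∑ p ∈ antidiagonal J, f p.1 p.2 := by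
  rw [← sum_product', sum_sigma', eq_comm]
  refine sum_subset_zero_on_sdiff (s₁ := ((range N).sigma fun J => antidiagonal J).image
      fun x => x.2) (s₂ := range N ×ˢ range N) (f := fun p => f p.1 p.2)
      (g := fun p => f p.1 p.2) ?_ ?_ (fun _ _ => rfl) |>.symm.trans ?_ |>.symm
  · intro p hp
    simp only [mem_image, mem_sigma, mem_range, HasAntidiagonal.mem_antidiagonal, Sigma.exists,
      mem_product] at hp ⊢
    obtain ⟨a, b, ⟨h1, h2⟩, rfl⟩ := hp
    omega
  · intro p hp
    simp only [Finset.mem_sdiff, mem_product, mem_range, mem_image, mem_sigma, HasAntidiagonal.mem_antidiagonal,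
      Sigma.exists, not_exists, not_and] at hp
    refine h _ _ ?_
    by_contra hlt
    exact hp.2 (p.1 + p.2) p ⟨by omega, rfl⟩ rfl
  · rw [sum_image]
    rintro ⟨a, b⟩ h1 ⟨c, d⟩ h2 (rfl : b = d)
    simp only [coe_sigma, Set.mem_sigma_iff, mem_coe, HasAntidiagonal.mem_antidiagonal] at h1 h2
    obtain rfl : a = c := by rw [← h1.2, ← h2.2]
    rfl

end Sums

/-! ### The Jacobi identity for covariant families of modes -/

section Jacobi

variable {ι U V W : Type*} [AddCommGroup U] [Module ℂ U] [AddCommGroup V] [Module ℂ V]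
  [AddCommGroup W] [Module ℂ W]

/-- The modes `F u m : V → W` satisfy the commutator formula
`[a(n), u(m)] = ∑ₖ (n choose k) (a(k)u)(n+m-k)` with respect to the operators `cU`, `cV`, `cW` by
which `a` acts on `U`, `V` and `W`. -/
def ModeCovariant (cU : ι → ℤ → Module.End ℂ U) (cV : ι → ℤ → Module.End ℂ V)
    (cW : ι → ℤ → Module.End ℂ W) (F : U →ₗ[ℂ] (ℤ → (V →ₗ[ℂ] W))) : Prop :=
  ∀ (i : ι) (n m : ℤ) (u : U) (v : V) (K : ℕ), (∀ k : ℕ, K ≤ k → cU i k u = 0) →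
    cW i n (F u m v) =
      F u m (cV i n v) + ∑ k ∈ range K, Ring.choose n k • F (cU i k u) (n + m - k) v

/-- Lower truncation: `u(n) v = 0` for `n` large. -/
def ModeTruncated (F : U →ₗ[ℂ] (ℤ → (V →ₗ[ℂ] W))) : Prop :=
  ∀ u v, ∃ N : ℤ, ∀ n : ℤ, N ≤ n → F u n v = 0

theorem ModeTruncated.eventually {F : U →ₗ[ℂ] (ℤ → (V →ₗ[ℂ] W))} (hF : ModeTruncated F)
    (u : U) (v : V) (q : ℤ) : ∀ᶠ j : ℕ in atTop, F u (q + j) v = 0 := by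
  obtain ⟨N, hN⟩ := hF u v
  filter_upwards [eventually_ge_atTop (N - q).toNat] with j hj
  exact hN _ (by omega)

variable (Y : V →ₗ[ℂ] (ℤ → Module.End ℂ V)) (YW : V →ₗ[ℂ] (ℤ → Module.End ℂ W))
  (I : W →ₗ[ℂ] (ℤ → (V →ₗ[ℂ] W)))

/-- The coefficient of `(z₁-z₂)^r Y_W(u,z₁) I(w,z₂) v`. -/
noncomputable def leftTerm (u : V) (w : W) (v : V) (p q r : ℤ) : W :=
  ∑ᶠ j : ℕ, ((-1) ^ j * Ring.choose r j : ℤ) • YW u (p + r - j) (I w (q + j) v)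

/-- The coefficient of `(-z₂+z₁)^r I(w,z₂) Y(u,z₁) v`. -/
noncomputable def rightTerm (u : V) (w : W) (v : V) (p q r : ℤ) : W :=
  ∑ᶠ j : ℕ, ((r.negOnePow : ℤ) * (-1) ^ j * Ring.choose r j : ℤ) • I w (q + r - j) (Y u (p + j) v)

/-- The coefficient of `z₂⁻¹ δ((z₁-z₀)/z₂) I(Y_W(u,z₀)w,z₂) v`. -/
noncomputable def iterTerm (u : V) (w : W) (v : V) (p q r : ℤ) : W :=
  ∑ᶠ j : ℕ, Ring.choose p j • I (YW u (r + j) w) (p + q - j) v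

/-- The defect of the Jacobi identity. -/
noncomputable def jacobiDefect (u : V) (w : W) (v : V) (p q r : ℤ) : W :=
  leftTerm YW I u w v p q r - rightTerm Y I u w v p q r - iterTerm YW I u w v p q r

variable {Y YW I}

theorem leftTerm_eq_sum {u : V} {w : W} {v : V} {p q r : ℤ} {N : ℕ}
    (h : ∀ j : ℕ, N ≤ j → I w (q + j) v = 0) :
    leftTerm YW I u w v p q r = ∑ j ∈ range N,
      ((-1) ^ j * Ring.choose r j : ℤ) • YW u (p + r - j) (I w (q + j) v) :=
  finsum_eq_sum_range fun j hj => by simp [h j hj]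

theorem rightTerm_eq_sum {u : V} {w : W} {v : V} {p q r : ℤ} {N : ℕ}
    (h : ∀ j : ℕ, N ≤ j → Y u (p + j) v = 0) :
    rightTerm Y I u w v p q r = ∑ j ∈ range N,
      ((r.negOnePow : ℤ) * (-1) ^ j * Ring.choose r j : ℤ) • I w (q + r - j) (Y u (p + j) v) :=
  finsum_eq_sum_range fun j hj => by simp [h j hj]

theorem iterTerm_eq_sum {u : V} {w : W} {v : V} {p q r : ℤ} {N : ℕ}
    (h : ∀ j : ℕ, N ≤ j → YW u (r + j) w = 0) :
    iterTerm YW I u w v p q r =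
      ∑ j ∈ range N, Ring.choose p j • I (YW u (r + j) w) (p + q - j) v :=
  finsum_eq_sum_range fun j hj => by simp [h j hj]

variable {cV : ι → ℤ → Module.End ℂ V} {cW : ι → ℤ → Module.End ℂ W}

/-- In generating functions, $[a(n),u(z_1)]=\sum_k\binom nk z_1^{n-k}(a(k)u)(z_1)$, and similarly
for $w(z_2)$. A factor $z_1^{n-k}$ shifts `p`, a factor $z_2^{n-k}$ shifts `q`, and $(z_1-z_2)^r$ is
untouched. -/
theorem leftTerm_covariant (hYW : ModeCovariant cV cW cW YW) (hI : ModeCovariant cW cV cW I)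
    (tI : ModeTruncated I) (i : ι) (n : ℤ) (u : V) (w : W) (v : V) (p q r : ℤ) {K K' : ℕ}
    (hK : ∀ k : ℕ, K ≤ k → cV i k u = 0) (hK' : ∀ k : ℕ, K' ≤ k → cW i k w = 0) :
    cW i n (leftTerm YW I u w v p q r) = leftTerm YW I u w (cV i n v) p q r +
      ∑ k ∈ range K, Ring.choose n k • leftTerm YW I (cV i k u) w v (p + n - k) q r +
      ∑ k ∈ range K', Ring.choose n k • leftTerm YW I u (cW i k w) v p (q + n - k) r := by
  obtain ⟨N, hN⟩ := (((tI.eventually w v q).and (tI.eventually w (cV i n v) q)).and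
    ((eventually_all_finset (range K')).2 fun k _ =>
      tI.eventually (cW i k w) v (q + n - k))).exists_forall_of_atTop
  rw [leftTerm_eq_sum fun j hj => (hN j hj).1.1, leftTerm_eq_sum fun j hj => (hN j hj).1.2]
  rw [sum_congr (s₁ := range K) rfl fun k _ => by rw [leftTerm_eq_sum fun j hj => (hN j hj).1.1, smul_sum],
    sum_comm (s := range K), sum_congr (s₁ := range K') rfl fun k hk => by
      rw [leftTerm_eq_sum fun j hj => (hN j hj).2 k hk, smul_sum],
    sum_comm (s := range K'), ← sum_add_distrib, ← sum_add_distrib, map_sum]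
  refine sum_congr rfl fun j _ => ?_
  rw [map_zsmul, hYW i n _ u _ K hK, hI i n _ w v K' hK', map_add, map_sum, smul_add, smul_add,
    smul_sum, smul_sum, add_right_comm]
  congr 1
  · congr 1
    refine sum_congr rfl fun k _ => ?_
    rw [smul_comm, show n + (p + r - j) - (k : ℤ) = p + n - k + r - j by ring]
  · refine sum_congr rfl fun k _ => ?_
    rw [map_zsmul, smul_comm, show n + (q + j) - (k : ℤ) = q + n - k + j by ring]

theorem rightTerm_covariant (hY : ModeCovariant cV cV cV Y) (hI : ModeCovariant cW cV cW I)
    (tY : ModeTruncated Y) (i : ι) (n : ℤ) (u : V) (w : W) (v : V) (p q r : ℤ) {K K' : ℕ}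
    (hK : ∀ k : ℕ, K ≤ k → cV i k u = 0) (hK' : ∀ k : ℕ, K' ≤ k → cW i k w = 0) :
    cW i n (rightTerm Y I u w v p q r) = rightTerm Y I u w (cV i n v) p q r +
      ∑ k ∈ range K, Ring.choose n k • rightTerm Y I (cV i k u) w v (p + n - k) q r +
      ∑ k ∈ range K', Ring.choose n k • rightTerm Y I u (cW i k w) v p (q + n - k) r := by
  obtain ⟨N, hN⟩ := (((tY.eventually u v p).and (tY.eventually u (cV i n v) p)).and
    ((eventually_all_finset (range K)).2 fun k _ =>
      tY.eventually (cV i k u) v (p + n - k))).exists_forall_of_atTop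
  rw [rightTerm_eq_sum fun j hj => (hN j hj).1.1, rightTerm_eq_sum fun j hj => (hN j hj).1.2]
  rw [sum_congr (s₁ := range K') rfl fun k _ => by
      rw [rightTerm_eq_sum fun j hj => (hN j hj).1.1, smul_sum],
    sum_comm (s := range K'), sum_congr (s₁ := range K) rfl fun k hk => by
      rw [rightTerm_eq_sum fun j hj => (hN j hj).2 k hk, smul_sum],
    sum_comm (s := range K), ← sum_add_distrib, ← sum_add_distrib, map_sum]
  refine sum_congr rfl fun j _ => ?_
  rw [map_zsmul, hI i n _ w _ K' hK', hY i n _ u v K hK, map_add, map_sum, smul_add, smul_add,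
    smul_sum, smul_sum]
  congr 1
  · congr 1
    refine sum_congr rfl fun k _ => ?_
    rw [map_zsmul, smul_comm, show n + (p + j) - (k : ℤ) = p + n - k + j by ring]
  · refine sum_congr rfl fun k _ => ?_
    rw [smul_comm, show n + (q + r - j) - (k : ℤ) = q + n - k + r - j by ring]

/-- Chu–Vandermonde convolution of the coefficients of an iterate. -/
theorem sum_choose_mul_choose_smul {M : Type*} [AddCommGroup M] (g : ℕ → M) (p n : ℤ) (k N I : ℕ)
    (hI : k + N ≤ I) (hg : ∀ J, N ≤ J → g J = 0) :
    ∑ j ∈ range N, ∑ i ∈ range I,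
      (Ring.choose p j * Ring.choose n i * (i.choose k : ℤ)) • g (i + j - k) =
    Ring.choose n k • ∑ J ∈ range N, Ring.choose (p + n - k) J • g J := by
  have h1 : ∀ j, ∑ i ∈ range I,
      (Ring.choose p j * Ring.choose n i * (i.choose k : ℤ)) • g (i + j - k) =
      ∑ i ∈ range N, (Ring.choose n k * (Ring.choose p j * Ring.choose (n - k) i)) • g (j + i) := by
    intro j
    -- For `i < k` the subtraction in `g (i + j - k)` may truncate, but the factor $\binom ik$ is
    -- then zero.
    have h2 : ∀ i, i < k →
        (Ring.choose p j * Ring.choose n i * (i.choose k : ℤ)) • g (i + j - k) = 0 := by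
      intro i hi
      rw [Nat.choose_eq_zero_of_lt hi]
      simp
    have h3 : ∀ i, k + N ≤ i →
        (Ring.choose p j * Ring.choose n i * (i.choose k : ℤ)) • g (i + j - k) = 0 := by
      intro i hi
      rw [hg _ (by omega), smul_zero]
    rw [sum_range_eq_sum_range (fun i hi => h3 i (hI.trans hi)) h3, sum_range_add,
      sum_eq_zero fun i hi => h2 i (mem_range.1 hi), zero_add]
    refine sum_congr rfl fun i _ => ?_
    rw [mul_assoc, Ring.choose_mul_choose, show k + i + j - k = j + i by omega]
    congr 1
    ring
  rw [sum_congr rfl fun j _ => h1 j, sum_range_range_antidiagonal (fun j i =>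
    (Ring.choose n k * (Ring.choose p j * Ring.choose (n - k) i)) • g (j + i)) N
      fun i j h => by rw [hg _ h, smul_zero], smul_sum]
  refine sum_congr rfl fun J _ => ?_
  rw [add_sub_assoc, Ring.add_choose_eq J (Commute.all p (n - k)), smul_smul, mul_sum, sum_smul]
  refine sum_congr rfl fun x hx => ?_
  rw [HasAntidiagonal.mem_antidiagonal.1 hx]

/-- Commuting $a(n)$ past the outer operator gives powers of $z_2$, and commuting the resulting
$a(k)$ past the inner one gives powers of $z_0$. They recombine through $(z_2+z_0)^{n-x}=z_1^{n-x}$,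
which is the Vandermonde convolution. All three terms of the identity thus transform alike. -/
theorem iterTerm_covariant (hYW : ModeCovariant cV cW cW YW) (hI : ModeCovariant cW cV cW I)
    (tYW : ModeTruncated YW) (tW : ∀ i w, ∀ᶠ k : ℕ in atTop, cW i k w = 0)
    (i : ι) (n : ℤ) (u : V) (w : W) (v : V) (p q r : ℤ) {K K' : ℕ}
    (hK : ∀ k : ℕ, K ≤ k → cV i k u = 0) (hK' : ∀ k : ℕ, K' ≤ k → cW i k w = 0) :
    cW i n (iterTerm YW I u w v p q r) = iterTerm YW I u w (cV i n v) p q r +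
      ∑ k ∈ range K, Ring.choose n k • iterTerm YW I (cV i k u) w v (p + n - k) q r +
      ∑ k ∈ range K', Ring.choose n k • iterTerm YW I u (cW i k w) v p (q + n - k) r := by
  obtain ⟨N, hN⟩ := (((tYW.eventually u w r).and
    ((eventually_all_finset (range K)).2 fun k _ => tYW.eventually (cV i k u) w r)).and
    ((eventually_all_finset (range K')).2 fun k _ =>
      tYW.eventually u (cW i k w) r)).exists_forall_of_atTop
  obtain ⟨M, hM⟩ := ((eventually_all_finset (range N)).2 fun j _ =>
      tW i (YW u (r + j) w)).exists_forall_of_atTop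
  -- Three demands on `R`: past `M` the modes kill every $u(r+j)w$ with $j<N$; past `K + N` the
  -- Vandermonde sums are complete; past `K'` the modes kill $w$.
  set R := max M (K + N + K') with hR
  have hM' : ∀ k, R ≤ k → ∀ j ∈ range N, cW i k (YW u (r + j) w) = 0 := fun k hk =>
    hM k (le_trans (le_max_left _ _) hk)
  have hRK : K + N + K' ≤ R := le_max_right _ _
  rw [iterTerm_eq_sum fun j hj => (hN j hj).1.1, iterTerm_eq_sum fun j hj => (hN j hj).1.1]
  rw [sum_congr (s₁ := range K) rfl fun k hk => by
      rw [iterTerm_eq_sum fun j hj => (hN j hj).1.2 k hk,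
        ← sum_choose_mul_choose_smul (fun J => I (YW (cV i k u) (r + J) w) (p + n - k + q - J) v)
        p n k N R (by have := mem_range.1 hk; omega)
          fun J hJ => by simp [(hN J hJ).1.2 k hk]],
    sum_comm (s := range K), sum_congr (s₁ := range K') rfl fun k hk => by
      rw [iterTerm_eq_sum fun j hj => (hN j hj).2 k hk, smul_sum],
    sum_comm (s := range K'), ← sum_add_distrib, ← sum_add_distrib, map_sum]
  refine sum_congr rfl fun j hj => ?_
  rw [map_zsmul, hI i n _ _ v R fun k hk => hM' k hk j hj, smul_add, add_assoc]
  congr 1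
  have h1 : ∀ k ∈ range R, Ring.choose n k • I (cW i k (YW u (r + j) w)) (n + (p + q - j) - k) v =
      (∑ x ∈ range K, (Ring.choose n k * (k.choose x : ℤ)) •
        I (YW (cV i x u) (r + ((k + j - x : ℕ) : ℤ)) w) (p + n - x + q - (k + j - x : ℕ)) v) +
      Ring.choose n k • I (YW u (r + j) (cW i k w)) (p + (q + n - k) - j) v := by
    intro k _
    rw [hYW i k _ u w K hK, map_add, map_sum, Pi.add_apply, LinearMap.add_apply, smul_add, add_comm,
      Finset.sum_apply, LinearMap.sum_apply, smul_sum]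
    congr 1
    · refine sum_congr rfl fun x _ => ?_
      rw [map_zsmul, Pi.smul_apply, LinearMap.smul_apply, Ring.choose_natCast, smul_smul]
      -- For `x > k` the natural subtraction `k + j - x` may truncate, but $\binom kx=0$ removes the
      -- term.
      by_cases hx : x ≤ k
      · push_cast [show x ≤ k + j by omega]
        rw [show (k : ℤ) + (r + j) - x = r + (k + j - x) by ring,
          show n + (p + q - (j : ℤ)) - k = p + n - x + q - (k + j - x) by ring]
      · rw [Nat.choose_eq_zero_of_lt (by omega)]
        simp
    · rw [show n + (p + q - (j : ℤ)) - k = p + (q + n - k) - j by ring]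
  rw [sum_congr rfl h1, sum_add_distrib, smul_add]
  congr 1
  · rw [smul_sum, sum_comm (s := range K)]
    refine sum_congr rfl fun k _ => ?_
    rw [smul_sum]
    refine sum_congr rfl fun x _ => ?_
    rw [smul_smul, mul_assoc]
  · rw [smul_sum, sum_range_eq_sum_range (N := R) (K := K')]
    · exact sum_congr rfl fun k _ => smul_comm _ _ _
    · intro k hk
      simp [hK' k hk]
    · intro k hk
      simp [hK' k (by omega)]

/-- This reduces the Jacobi identity to the vacuum: if the defect vanishes at `v` for all other
arguments, it vanishes at $a(n)v$. -/
theorem jacobiDefect_covariant (hY : ModeCovariant cV cV cV Y) (hYW : ModeCovariant cV cW cW YW)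
    (hI : ModeCovariant cW cV cW I) (tY : ModeTruncated Y) (tYW : ModeTruncated YW)
    (tI : ModeTruncated I) (tW : ∀ i w, ∀ᶠ k : ℕ in atTop, cW i k w = 0)
    (i : ι) (n : ℤ) (u : V) (w : W) (v : V) (p q r : ℤ) {K K' : ℕ}
    (hK : ∀ k : ℕ, K ≤ k → cV i k u = 0) (hK' : ∀ k : ℕ, K' ≤ k → cW i k w = 0) :
    cW i n (jacobiDefect Y YW I u w v p q r) = jacobiDefect Y YW I u w (cV i n v) p q r +
      ∑ k ∈ range K, Ring.choose n k • jacobiDefect Y YW I (cV i k u) w v (p + n - k) q r +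
      ∑ k ∈ range K', Ring.choose n k • jacobiDefect Y YW I u (cW i k w) v p (q + n - k) r := by
  simp only [jacobiDefect, map_sub, leftTerm_covariant hYW hI tI i n u w v p q r hK hK',
    rightTerm_covariant hY hI tY i n u w v p q r hK hK',
    iterTerm_covariant hYW hI tYW tW i n u w v p q r hK hK', smul_sub, sum_sub_distrib]
  abel

end Jacobi

/-! ### Binomials with negative upper entry, and a telescoping sum -/

theorem Ring.choose_neg_succ (s k : ℕ) :
    Ring.choose (-(s : ℤ) - 1) k = (-1) ^ k * ((k + s).choose k : ℤ) := by
  rw [← Ring.neg_one_pow_mul_choose, show (k : ℤ) - (-(s : ℤ) - 1) - 1 = ((k + s : ℕ) : ℤ) by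
    push_cast; ring, Ring.choose_natCast]

theorem Ring.choose_neg_one (k : ℕ) : Ring.choose (-1 : ℤ) k = (-1) ^ k := by
  simpa using Ring.choose_neg_succ 0 k

section Telescoping

variable {M : Type*} [AddCommGroup M]

/-- Coefficient form of $(\partial_{z_1}+\partial_{z_2})(z_1-z_2)^r=0$: neighbouring terms cancel
because $(j+1)\binom r{j+1}=(r-j)\binom rj$. -/
theorem sum_telescoping (r : ℤ) (g : ℕ → M) (N : ℕ) (hg : g N = 0) :
    ∑ j ∈ range (N + 1), ((j : ℤ) * ((-1) ^ j * Ring.choose r j)) • g (j - 1) +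
      ∑ j ∈ range (N + 1), ((r - j) * ((-1) ^ j * Ring.choose r j)) • g j = 0 := by
  rw [sum_range_succ', sum_range_succ _ N, hg, smul_zero, add_zero, Nat.cast_zero, zero_mul,
    zero_smul, add_zero, ← sum_add_distrib]
  refine sum_eq_zero fun j _ => ?_
  rw [Nat.add_sub_cancel, ← add_smul]
  have h1 := Ring.choose_succ_mul r j
  have h2 := Ring.sub_mul_choose r j
  rw [show ((j + 1 : ℕ) : ℤ) * ((-1) ^ (j + 1) * Ring.choose r (j + 1)) +
    (r - j) * ((-1) ^ j * Ring.choose r j) = (-1) ^ j * ((r - j) * Ring.choose r j -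
      ((j : ℤ) + 1) * Ring.choose r (j + 1)) by push_cast; ring, h1, h2, sub_self, mul_zero,
    zero_smul]

end Telescoping

/-! ### The Jacobi identity on the vacuum and its extension to all vectors -/

section Vacuum

variable {ι V W : Type*} [AddCommGroup V] [Module ℂ V] [AddCommGroup W] [Module ℂ W]

/-- Vertex operators `Y` on `V` and `YW` on `W` together with a creative operator `I`, which are
covariant under operators `cV`, `cW` and translation covariant under `LV`, `LW`, where `V` is
generated from `vac` by the `cV i (-s-1)` and `YW (cV i (-s-1) u)` is a normally ordered product. -/
structure FreelyGenerated (cV : ι → ℤ → Module.End ℂ V) (cW : ι → ℤ → Module.End ℂ W) (vac : V)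
    (LV : Module.End ℂ V) (LW : Module.End ℂ W) (Y : V →ₗ[ℂ] (ℤ → Module.End ℂ V))
    (YW : V →ₗ[ℂ] (ℤ → Module.End ℂ W)) (I : W →ₗ[ℂ] (ℤ → (V →ₗ[ℂ] W))) : Prop where
  covY : ModeCovariant cV cV cV Y
  covYW : ModeCovariant cV cW cW YW
  covI : ModeCovariant cW cV cW I
  truncY : ModeTruncated Y
  truncYW : ModeTruncated YW
  truncI : ModeTruncated I
  truncV : ∀ i u, ∀ᶠ k : ℕ in atTop, cV i k u = 0
  truncW : ∀ i w, ∀ᶠ k : ℕ in atTop, cW i k w = 0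
  creatY : ∀ u, Y u (-1) vac = u
  creatY_nonneg : ∀ u (n : ℤ), 0 ≤ n → Y u n vac = 0
  creatI : ∀ w, I w (-1) vac = w
  creatI_nonneg : ∀ w (n : ℤ), 0 ≤ n → I w n vac = 0
  transl_vac : LV vac = 0
  translY : ∀ u (m : ℤ) v, LV (Y u m v) = Y u m (LV v) + (-m) • Y u (m - 1) v
  translYW : ∀ u (m : ℤ) w, LW (YW u m w) = YW u m (LW w) + (-m) • YW u (m - 1) w
  translI : ∀ w (m : ℤ) v, LW (I w m v) = I w m (LV v) + (-m) • I w (m - 1) v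
  transl_mode : ∀ i (n : ℤ) w, cW i n (LW w) = LW (cW i n w) + n • cW i (n - 1) w
  YW_vac : ∀ (n : ℤ) w, YW vac n w = if n = -1 then w else 0
  normal : ∀ i (s : ℕ) u (n : ℤ) w (J K : ℕ), (∀ m : ℕ, J ≤ m → YW u (n + m) w = 0) →
    (∀ k : ℕ, K ≤ k → cW i k w = 0) →
    YW (cV i (-(s : ℤ) - 1) u) n w =
      ∑ m ∈ range J, ((m + s).choose s : ℤ) • cW i (-(m : ℤ) - s - 1) (YW u (n + m) w) +
      ∑ k ∈ range K, Ring.choose (-(k : ℤ) - 1) s • YW u (n - k - 1 - s) (cW i k w)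
  generated : ∀ P : V → Prop, P vac → (∀ u v, P u → P v → P (u + v)) →
    (∀ (c : ℂ) u, P u → P (c • u)) → (∀ i (s : ℕ) u, P u → P (cV i (-(s : ℤ) - 1) u)) → ∀ u, P u

variable {cV : ι → ℤ → Module.End ℂ V} {cW : ι → ℤ → Module.End ℂ W} {vac : V}
  {LV : Module.End ℂ V} {LW : Module.End ℂ W} {Y : V →ₗ[ℂ] (ℤ → Module.End ℂ V)}
  {YW : V →ₗ[ℂ] (ℤ → Module.End ℂ W)} {I : W →ₗ[ℂ] (ℤ → (V →ₗ[ℂ] W))}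

/-- Multiplication by $z_1-z_2$, which turns $(z_1-z_2)^r$ into $(z_1-z_2)^{r+1}$. In coefficients
this is Pascal's rule. -/
theorem leftTerm_shift (tI : ModeTruncated I) (u : V) (w : W) (v : V) (p q r : ℤ) :
    leftTerm YW I u w v (p + 1) q r - leftTerm YW I u w v p (q + 1) r =
      leftTerm YW I u w v p q (r + 1) := by
  obtain ⟨N, hN⟩ := (tI.eventually w v q).exists_forall_of_atTop
  have h1 : ∀ j, N + 1 ≤ j → I w (q + j) v = 0 := fun j hj => hN j (by omega)
  have h2 : ∀ j : ℕ, N ≤ j → I w (q + 1 + j) v = 0 := fun j hj => by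
    have := hN (j + 1) (by omega)
    rwa [show q + 1 + (j : ℤ) = q + ((j + 1 : ℕ) : ℤ) by push_cast; ring]
  rw [leftTerm_eq_sum h1, leftTerm_eq_sum h1, leftTerm_eq_sum h2, sum_range_succ',
    sum_range_succ', add_sub_right_comm, ← sum_sub_distrib]
  congr 1
  · refine sum_congr rfl fun j _ => ?_
    rw [Ring.choose_succ_succ]
    push_cast
    rw [show p + 1 + r - ((j : ℤ) + 1) = p + r - j by ring,
      show p + (r + 1) - ((j : ℤ) + 1) = p + r - j by ring,
      show q + 1 + (j : ℤ) = q + (j + 1) by ring, ← sub_smul]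
    congr 1
    ring
  · rw [show p + 1 + r = p + (r + 1) by ring]
    simp

theorem rightTerm_shift (tY : ModeTruncated Y) (u : V) (w : W) (v : V) (p q r : ℤ) :
    rightTerm Y I u w v (p + 1) q r - rightTerm Y I u w v p (q + 1) r =
      rightTerm Y I u w v p q (r + 1) := by
  obtain ⟨N, hN⟩ := (tY.eventually u v p).exists_forall_of_atTop
  have h1 : ∀ j, N + 1 ≤ j → Y u (p + j) v = 0 := fun j hj => hN j (by omega)
  have h2 : ∀ j : ℕ, N ≤ j → Y u (p + 1 + j) v = 0 := fun j hj => by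
    have := hN (j + 1) (by omega)
    rwa [show p + 1 + (j : ℤ) = p + ((j + 1 : ℕ) : ℤ) by push_cast; ring]
  rw [rightTerm_eq_sum h1, rightTerm_eq_sum h1, rightTerm_eq_sum h2, sum_range_succ',
    sum_range_succ', sub_add_eq_sub_sub, ← sum_sub_distrib, Int.negOnePow_succ, sub_eq_add_neg]
  congr 1
  · refine sum_congr rfl fun j _ => ?_
    rw [Ring.choose_succ_succ]
    push_cast
    rw [show q + 1 + r - ((j : ℤ) + 1) = q + r - j by ring,
      show q + (r + 1) - ((j : ℤ) + 1) = q + r - j by ring,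
      show p + 1 + (j : ℤ) = p + (j + 1) by ring, ← sub_smul]
    congr 1
    ring
  · rw [← neg_smul, show q + 1 + r = q + (r + 1) by ring]
    simp

/-- On the iterate side $z_1-z_2$ acts as $z_0$, hence raises `r`. Pascal's rule is applied here to
$\binom pj$. -/
theorem iterTerm_shift (tYW : ModeTruncated YW) (u : V) (w : W) (v : V) (p q r : ℤ) :
    iterTerm YW I u w v (p + 1) q r - iterTerm YW I u w v p (q + 1) r =
      iterTerm YW I u w v p q (r + 1) := by
  obtain ⟨N, hN⟩ := (tYW.eventually u w r).exists_forall_of_atTop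
  have h1 : ∀ j, N + 1 ≤ j → YW u (r + j) w = 0 := fun j hj => hN j (by omega)
  have h2 : ∀ j : ℕ, N ≤ j → YW u (r + 1 + j) w = 0 := fun j hj => by
    have := hN (j + 1) (by omega)
    rwa [show r + 1 + (j : ℤ) = r + ((j + 1 : ℕ) : ℤ) by push_cast; ring]
  rw [iterTerm_eq_sum h1, iterTerm_eq_sum h1, iterTerm_eq_sum h2, sum_range_succ',
    sum_range_succ', add_sub_add_comm, ← sum_sub_distrib]
  refine (congrArg₂ (· + ·) ?_ ?_).trans (add_zero _)
  · refine sum_congr rfl fun j _ => ?_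
    rw [Ring.choose_succ_succ]
    push_cast
    rw [show p + 1 + q - ((j : ℤ) + 1) = p + q - j by ring,
      show p + (q + 1) - ((j : ℤ) + 1) = p + q - j by ring,
      show r + 1 + (j : ℤ) = r + (j + 1) by ring, ← sub_smul]
    congr 1
    ring
  · rw [show p + 1 + q = p + (q + 1) by ring]
    simp

namespace FreelyGenerated

theorem eq_zero_of_zsmul {m : ℤ} (hm : m ≠ 0) {x : W} (hx : m • x = 0) : x = 0 := by
  rw [← Int.cast_smul_eq_zsmul ℂ] at hx
  exact (smul_eq_zero.1 hx).resolve_left (by exact_mod_cast hm)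

variable (h : FreelyGenerated cV cW vac LV LW Y YW I)

include h

theorem jacobiDefect_shift (u : V) (w : W) (v : V) (p q r : ℤ) :
    jacobiDefect Y YW I u w v (p + 1) q r - jacobiDefect Y YW I u w v p (q + 1) r =
      jacobiDefect Y YW I u w v p q (r + 1) := by
  simp only [jacobiDefect, ← leftTerm_shift h.truncI, ← rightTerm_shift h.truncY,
    ← iterTerm_shift h.truncYW]
  abel

theorem translI_vac (w : W) (m : ℤ) : LW (I w m vac) = (-m) • I w (m - 1) vac := by
  rw [h.translI, h.transl_vac, map_zero, zero_add]

theorem translY_vac (u : V) (m : ℤ) : LV (Y u m vac) = (-m) • Y u (m - 1) vac := by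
  rw [h.translY, h.transl_vac, map_zero, zero_add]

/-- Since $L(-1)$ kills the vacuum, it acts as $\partial_{z_1}+\partial_{z_2}$ on the product of the
two operators, and this derivation annihilates $(z_1-z_2)^r$. The cancellation is `sum_telescoping`.
-/
theorem leftTerm_transl (u : V) (w : W) (p q r : ℤ) :
    LW (leftTerm YW I u w vac p q r) =
      (-p) • leftTerm YW I u w vac (p - 1) q r + (-q) • leftTerm YW I u w vac p (q - 1) r := by
  obtain ⟨N, hN⟩ := (h.truncI.eventually w vac (q - 1)).exists_forall_of_atTop
  have h1 : ∀ j : ℕ, N ≤ j → I w (q + j) vac = 0 := fun j hj => by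
    have := hN (j + 1) (by omega)
    rwa [show q + (j : ℤ) = q - 1 + ((j + 1 : ℕ) : ℤ) by push_cast; ring]
  have h2 : ∀ j : ℕ, N + 1 ≤ j → I w (q + j) vac = 0 := fun j hj => h1 j (by omega)
  have h3 : ∀ j : ℕ, N + 1 ≤ j → I w (q - 1 + j) vac = 0 := fun j hj => hN j (by omega)
  rw [leftTerm_eq_sum h2, leftTerm_eq_sum h2, leftTerm_eq_sum h3, map_sum, smul_sum, smul_sum,
    ← sum_add_distrib, ← sub_eq_zero, ← sum_sub_distrib, ← neg_eq_zero,
    ← sum_telescoping r (fun j : ℕ => YW u (p + r - 1 - j) (I w (q + j) vac)) N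
      (by simp [h1 N le_rfl]), ← sum_add_distrib, ← sum_neg_distrib]
  refine sum_congr rfl fun j _ => ?_
  -- At `j = 0` the truncated `j - 1` is harmless because its weight is $j=0$.
  have h4 : ((j : ℤ) * ((-1) ^ j * Ring.choose r j)) •
      YW u (p + r - 1 - ((j - 1 : ℕ) : ℤ)) (I w (q + ((j - 1 : ℕ) : ℤ)) vac) =
      ((j : ℤ) * ((-1) ^ j * Ring.choose r j)) • YW u (p + r - j) (I w (q - 1 + j) vac) := by
    rcases j with _ | j
    · simp
    · rw [Nat.add_sub_cancel, show p + r - 1 - (j : ℤ) = p + r - ((j + 1 : ℕ) : ℤ) by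
        push_cast; ring, show q + (j : ℤ) = q - 1 + ((j + 1 : ℕ) : ℤ) by push_cast; ring]
  rw [h4, map_zsmul, h.translYW, h.translI_vac, map_zsmul,
    show q + (j : ℤ) - 1 = q - 1 + j by ring, show p + r - (j : ℤ) - 1 = p + r - 1 - j by ring,
    show p - 1 + r - (j : ℤ) = p + r - 1 - j by ring]
  module

theorem rightTerm_transl (u : V) (w : W) (p q r : ℤ) :
    LW (rightTerm Y I u w vac p q r) =
      (-p) • rightTerm Y I u w vac (p - 1) q r + (-q) • rightTerm Y I u w vac p (q - 1) r := by
  obtain ⟨N, hN⟩ := (h.truncY.eventually u vac (p - 1)).exists_forall_of_atTop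
  have h1 : ∀ j : ℕ, N ≤ j → Y u (p + j) vac = 0 := fun j hj => by
    have := hN (j + 1) (by omega)
    rwa [show p + (j : ℤ) = p - 1 + ((j + 1 : ℕ) : ℤ) by push_cast; ring]
  have h2 : ∀ j : ℕ, N + 1 ≤ j → Y u (p + j) vac = 0 := fun j hj => h1 j (by omega)
  have h3 : ∀ j : ℕ, N + 1 ≤ j → Y u (p - 1 + j) vac = 0 := fun j hj => hN j (by omega)
  rw [rightTerm_eq_sum h2, rightTerm_eq_sum h2, rightTerm_eq_sum h3, map_sum, smul_sum, smul_sum,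
    ← sum_add_distrib, ← sub_eq_zero, ← sum_sub_distrib,
    ← smul_zero (-(r.negOnePow : ℤ)),
    ← sum_telescoping r (fun j : ℕ => I w (q + r - 1 - j) (Y u (p + j) vac)) N
      (by simp [h1 N le_rfl]), ← sum_add_distrib, smul_sum]
  refine sum_congr rfl fun j _ => ?_
  have h4 : ((j : ℤ) * ((-1) ^ j * Ring.choose r j)) •
      I w (q + r - 1 - ((j - 1 : ℕ) : ℤ)) (Y u (p + ((j - 1 : ℕ) : ℤ)) vac) =
      ((j : ℤ) * ((-1) ^ j * Ring.choose r j)) • I w (q + r - j) (Y u (p - 1 + j) vac) := by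
    rcases j with _ | j
    · simp
    · rw [Nat.add_sub_cancel, show q + r - 1 - (j : ℤ) = q + r - ((j + 1 : ℕ) : ℤ) by
        push_cast; ring, show p + (j : ℤ) = p - 1 + ((j + 1 : ℕ) : ℤ) by push_cast; ring]
  rw [h4, map_zsmul, h.translI, h.translY_vac, map_zsmul,
    show p + (j : ℤ) - 1 = p - 1 + j by ring, show q + r - (j : ℤ) - 1 = q + r - 1 - j by ring,
    show q - 1 + r - (j : ℤ) = q + r - 1 - j by ring]
  module

/-- Only the outer operator is differentiated; the factor splits by $(p+q-j)\binom
pj=p\binom{p-1}j+q\binom pj$. -/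
theorem iterTerm_transl (u : V) (w : W) (p q r : ℤ) :
    LW (iterTerm YW I u w vac p q r) =
      (-p) • iterTerm YW I u w vac (p - 1) q r + (-q) • iterTerm YW I u w vac p (q - 1) r := by
  obtain ⟨N, hN⟩ := (h.truncYW.eventually u w r).exists_forall_of_atTop
  rw [iterTerm_eq_sum hN, iterTerm_eq_sum hN, iterTerm_eq_sum hN, map_sum, smul_sum, smul_sum,
    ← sum_add_distrib]
  refine sum_congr rfl fun j _ => ?_
  rw [map_zsmul, h.translI_vac, smul_smul, smul_smul, smul_smul,
    show p - 1 + q - (j : ℤ) = p + q - j - 1 by ring,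
    show p + (q - 1) - (j : ℤ) = p + q - j - 1 by ring, ← add_smul, neg_mul,
    ← Ring.sub_mul_choose]
  congr 1
  ring

theorem jacobiDefect_transl (u : V) (w : W) (p q r : ℤ) :
    LW (jacobiDefect Y YW I u w vac p q r) =
      (-p) • jacobiDefect Y YW I u w vac (p - 1) q r +
        (-q) • jacobiDefect Y YW I u w vac p (q - 1) r := by
  simp only [jacobiDefect, map_sub, h.leftTerm_transl, h.rightTerm_transl, h.iterTerm_transl,
    smul_sub]
  abel

theorem rightTerm_vac_of_nonneg (u : V) (w : W) {p : ℤ} (hp : 0 ≤ p) (q r : ℤ) :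
    rightTerm Y I u w vac p q r = 0 := by
  rw [rightTerm_eq_sum (N := 0) fun j _ => h.creatY_nonneg u _ (by omega), sum_range_zero]

/-- Both products vanish by creativity. In the iterate, $j\le p$ leaves a nonnegative mode on the
vacuum, and $j>p$ gives $\binom pj=0$. -/
theorem jacobiDefect_vac_of_nonneg (u : V) (w : W) {p q : ℤ} (hp : 0 ≤ p) (hq : 0 ≤ q) (r : ℤ) :
    jacobiDefect Y YW I u w vac p q r = 0 := by
  rw [jacobiDefect, h.rightTerm_vac_of_nonneg u w hp,
    leftTerm_eq_sum (N := 0) fun j _ => h.creatI_nonneg w _ (by omega), sum_range_zero, sub_zero,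
    zero_sub, neg_eq_zero, iterTerm]
  refine finsum_eq_zero_of_forall_eq_zero fun j => ?_
  by_cases hj : (j : ℤ) ≤ p
  · rw [h.creatI_nonneg _ _ (by omega), smul_zero]
  · rw [Ring.choose_int_nat_eq_zero hp (by omega), zero_smul]

/-- Only $j=0$ survives on the left and $j=p$ in the iterate; both terms equal $u(p+r)w$. -/
theorem jacobiDefect_vac_neg_one (u : V) (w : W) {p : ℤ} (hp : 0 ≤ p) (r : ℤ) :
    jacobiDefect Y YW I u w vac p (-1) r = 0 := by
  rw [jacobiDefect, h.rightTerm_vac_of_nonneg u w hp,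
    leftTerm_eq_sum (N := 1) fun j _ => h.creatI_nonneg w _ (by omega), sum_range_one, sub_zero,
    iterTerm, sub_eq_zero]
  lift p to ℕ using hp
  rw [finsum_eq_single _ p]
  · rw [Ring.choose_natCast, Nat.choose_self, Nat.cast_one, one_smul,
      show (p : ℤ) + -1 - p = -1 by ring, h.creatI]
    simp [h.creatI, add_comm]
  · intro j hj
    rcases lt_or_gt_of_ne hj with hj | hj
    · rw [h.creatI_nonneg _ _ (by omega), smul_zero]
    · rw [Ring.choose_int_nat_eq_zero (by omega) (by omega), zero_smul]

/-- Descent in `q` by the translation recursion. The coefficient $-q$ of the new term is nonzero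
because $q<0$, and $p\,D(p-1,q)$ vanishes since either $p=0$ or $p-1\ge0$. -/
theorem jacobiDefect_vac_of_nonneg_left (u : V) (w : W) {p : ℤ} (hp : 0 ≤ p) (q r : ℤ) :
    jacobiDefect Y YW I u w vac p q r = 0 := by
  rcases le_or_gt 0 q with hq | hq
  · exact h.jacobiDefect_vac_of_nonneg u w hp hq r
  obtain ⟨n, rfl⟩ : ∃ n : ℕ, q = -1 - n := ⟨(-1 - q).toNat, by omega⟩
  clear hq
  induction n generalizing p with
  | zero => simpa using h.jacobiDefect_vac_neg_one u w hp r
  | succ n ih =>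
    have h1 := h.jacobiDefect_transl u w p (-1 - n) r
    have h2 : p • jacobiDefect Y YW I u w vac (p - 1) (-1 - n) r = 0 := by
      rcases hp.eq_or_lt with rfl | hp
      · rw [zero_smul]
      · rw [ih (by omega), smul_zero]
    rw [ih hp, map_zero, neg_smul, h2, neg_zero, zero_add] at h1
    have h3 := eq_zero_of_zsmul (by omega) h1.symm
    rwa [show -1 - ((n + 1 : ℕ) : ℤ) = -1 - (n : ℤ) - 1 by push_cast; ring]

/-- The operators `x ↦ x(-1-J) vac` (the divided powers of the translation operator) satisfy the
Leibniz rule. -/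
theorem mode_creat (i : ι) (n : ℤ) (J : ℕ) (x : W) :
    cW i n (I x (-1 - J) vac) =
      ∑ y ∈ antidiagonal J, Ring.choose n y.2 • I (cW i (n - y.2) x) (-1 - y.1) vac := by
  induction J generalizing n with
  | zero => simp [h.creatI]
  | succ J ih =>
    have hs : ∀ (j : ℕ) (y : W), LW (I y (-1 - j) vac) = ((j : ℤ) + 1) •
        I y (-1 - ((j + 1 : ℕ) : ℤ)) vac := fun j y => by
      rw [h.translI_vac, show -(-1 - (j : ℤ)) = j + 1 by ring,
        show -1 - (j : ℤ) - 1 = -1 - ((j + 1 : ℕ) : ℤ) by push_cast; ring]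
    refine sub_eq_zero.1 (eq_zero_of_zsmul (m := (J : ℤ) + 1) (by omega) ?_)
    rw [smul_sub, sub_eq_zero, ← map_zsmul, ← hs, h.transl_mode, ih, ih, map_sum]
    have h1 : ∑ y ∈ antidiagonal J, LW (Ring.choose n y.2 • I (cW i (n - y.2) x) (-1 - y.1) vac) =
        ∑ y ∈ antidiagonal (J + 1), ((y.1 : ℤ) * Ring.choose n y.2) •
          I (cW i (n - y.2) x) (-1 - y.1) vac := by
      rw [Nat.sum_antidiagonal_succ, Nat.cast_zero, zero_mul, zero_smul, zero_add]
      refine sum_congr rfl fun y _ => ?_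
      rw [map_zsmul, hs, smul_smul, mul_comm]
      push_cast
      rfl
    have h2 : n • ∑ y ∈ antidiagonal J, Ring.choose (n - 1) y.2 •
          I (cW i (n - 1 - y.2) x) (-1 - y.1) vac =
        ∑ y ∈ antidiagonal (J + 1), ((y.2 : ℤ) * Ring.choose n y.2) •
          I (cW i (n - y.2) x) (-1 - y.1) vac := by
      rw [Nat.sum_antidiagonal_succ', Nat.cast_zero, zero_mul, zero_smul, zero_add, smul_sum]
      refine sum_congr rfl fun y _ => ?_
      rw [smul_smul, ← Ring.choose_succ_mul]
      push_cast
      rw [show n - 1 - (y.2 : ℤ) = n - (y.2 + 1) by ring]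
    rw [h1, h2, ← sum_add_distrib, smul_sum]
    refine sum_congr rfl fun y hy => ?_
    rw [← add_smul, smul_smul, ← add_mul]
    have := HasAntidiagonal.mem_antidiagonal.1 hy
    congr 2
    exact_mod_cast this

/-- Skew symmetry. -/
theorem skew_symmetry (u : V) (w : W) (r : ℤ) :
    I w r u = (-(r.negOnePow : ℤ)) • ∑ᶠ j : ℕ, ((-1) ^ j : ℤ) • I (YW u (r + j) w) (-1 - j) vac := by
  have hfin : ∀ (u : V) (w : W) (r : ℤ),
      (Function.support fun j : ℕ => ((-1) ^ j : ℤ) • I (YW u (r + j) w) (-1 - j) vac).Finite := by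
    intro u w r
    obtain ⟨N, hN⟩ := (h.truncYW.eventually u w r).exists_forall_of_atTop
    refine (range N).finite_toSet.subset fun j hj => ?_
    by_contra hj'
    simp only [coe_range, Set.mem_Iio, not_lt] at hj'
    exact hj (by simp [hN j hj'])
  revert w r
  refine h.generated (fun u => ∀ (w : W) (r : ℤ), I w r u = (-(r.negOnePow : ℤ)) •
    ∑ᶠ j : ℕ, ((-1) ^ j : ℤ) • I (YW u (r + j) w) (-1 - j) vac) ?_ ?_ ?_ ?_ u
  · intro w r
    rcases le_or_gt 0 r with hr | hr
    · rw [h.creatI_nonneg w r hr, finsum_eq_zero_of_forall_eq_zero, smul_zero]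
      intro j
      rw [h.YW_vac, if_neg (by omega), map_zero]
      simp
    · obtain ⟨n, rfl⟩ : ∃ n : ℕ, r = -1 - n := ⟨(-1 - r).toNat, by omega⟩
      rw [finsum_eq_single _ n]
      · rw [h.YW_vac, if_pos (by ring), smul_smul, Int.negOnePow_sub, Int.negOnePow_neg]
        simp [← mul_pow, Int.negOnePow_def]
      · intro j hj
        rw [h.YW_vac, if_neg (by omega), map_zero]
        simp
  · intro u v hu hv w r
    rw [map_add, hu, hv, ← smul_add, ← finsum_add_distrib (hfin u w r) (hfin v w r)]
    simp
  · intro c u hu w r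
    rw [map_smul, hu, smul_comm, smul_finsum' c (hfin u w r)]
    congr 1
    refine finsum_congr fun j => ?_
    rw [smul_comm]
    simp
  · intro i s u hu w r
    obtain ⟨K, hK⟩ := (h.truncW i w).exists_forall_of_atTop
    obtain ⟨N, hN⟩ := (((h.truncYW.eventually u w r).and
      (h.truncYW.eventually (cV i (-(s : ℤ) - 1) u) w r)).and
      ((eventually_all_finset (range K)).2 fun k _ =>
        h.truncYW.eventually u (cW i k w) (-(s : ℤ) - 1 + r - k))).exists_forall_of_atTop
    -- The commutator formula expands the left side and `normal` expands the right side. The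
    -- creation parts agree by the Leibniz rule `mode_creat`, the annihilation parts agree with the
    -- commutator terms.
    have hc := h.covI i (-(s : ℤ) - 1) r w u K hK
    rw [hu, sum_congr rfl fun k _ => by rw [hu]] at hc
    rw [finsum_eq_sum_range (N := N) fun j hj => by simp [(hN j hj).1.1],
      sum_congr (s₁ := range K) rfl fun k hk => by
        rw [finsum_eq_sum_range (N := N) fun j hj => by simp [(hN j hj).2 k hk]]] at hc
    rw [← sub_eq_iff_eq_add] at hc
    rw [finsum_eq_sum_range (N := N) fun j hj => by simp [(hN j hj).1.2]]
    rw [sum_congr (s₁ := range N) (s₂ := range N) rfl fun j hj => by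
      rw [h.normal i s u (r + j) w N K (fun m hm => by
        rw [add_assoc]; exact_mod_cast (hN (j + m) (by omega)).1.1) hK, map_add, Pi.add_apply,
        LinearMap.add_apply, smul_add], sum_add_distrib, smul_add, ← hc, sub_eq_add_neg]
    congr 1
    · rw [map_zsmul, map_sum]
      congr 1
      have h1 : ∀ J ∈ range N, cW i (-(s : ℤ) - 1)
          (((-1) ^ J : ℤ) • I (YW u (r + J) w) (-1 - J) vac) =
          ∑ y ∈ antidiagonal J, (((-1) ^ y.1 : ℤ) * ((y.2 + s).choose s : ℤ)) •
            I (cW i (-(y.2 : ℤ) - s - 1) (YW u (r + ((y.1 + y.2 : ℕ) : ℤ)) w)) (-1 - y.1) vac := by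
        intro J _
        rw [map_zsmul, h.mode_creat, smul_sum]
        refine sum_congr rfl fun y hy => ?_
        rw [← HasAntidiagonal.mem_antidiagonal.1 hy, Ring.choose_neg_succ, smul_smul,
          Nat.choose_symm_add, show -(s : ℤ) - 1 - y.2 = -(y.2 : ℤ) - s - 1 by ring]
        congr 1
        rw [pow_add, mul_assoc, ← mul_assoc ((-1 : ℤ) ^ y.2), ← mul_pow]
        simp
      rw [sum_congr rfl h1, ← sum_range_range_antidiagonal (fun j m =>
        (((-1) ^ j : ℤ) * ((m + s).choose s : ℤ)) •
            I (cW i (-(m : ℤ) - s - 1) (YW u (r + ((j + m : ℕ) : ℤ)) w)) (-1 - j) vac) N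
            fun j m hjm => by rw [(hN (j + m) hjm).1.1]; simp]
      refine sum_congr rfl fun j _ => ?_
      rw [map_sum, Finset.sum_apply, LinearMap.sum_apply, smul_sum]
      refine sum_congr rfl fun m _ => ?_
      rw [map_zsmul, Pi.smul_apply, LinearMap.smul_apply, smul_smul, Nat.cast_add, add_assoc]
    · rw [← sum_neg_distrib, smul_sum]
      simp only [smul_sum, ← sum_neg_distrib]
      rw [sum_comm]
      refine sum_congr rfl fun j _ => ?_
      rw [map_sum, Finset.sum_apply, LinearMap.sum_apply, smul_sum, smul_sum]
      refine sum_congr rfl fun k _ => ?_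
      rw [map_zsmul, Pi.smul_apply, LinearMap.smul_apply, smul_smul, smul_smul, smul_smul, smul_smul,
        ← neg_smul, show r + (j : ℤ) - k - 1 - s = -(s : ℤ) - 1 + r - k + j by ring,
        Ring.choose_neg_succ, Ring.choose_neg_succ, Nat.choose_symm_add, Nat.add_comm s k]
      congr 1
      rw [show -(s : ℤ) - 1 + r - k = r - ((s + 1 + k : ℕ) : ℤ) by push_cast; ring,
        Int.negOnePow_sub]
      rw [Int.negOnePow_def ((s + 1 + k : ℕ) : ℤ), zpow_natCast]
      push_cast
      rw [pow_add, pow_add]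
      have hk : ((-1 : ℤ) ^ k) * (-1) ^ k = 1 := by rw [← mul_pow]; simp
      linear_combination (-(r.negOnePow : ℤ) * (-1) ^ s * (k + s).choose s * (-1) ^ j) * hk

/-- This case is skew symmetry itself: the left term vanishes, the right one is $(-1)^r w(r)u$, and
$\binom{-1}j=(-1)^j$. -/
theorem jacobiDefect_vac_neg_one_zero (u : V) (w : W) (r : ℤ) :
    jacobiDefect Y YW I u w vac (-1) 0 r = 0 := by
  rw [jacobiDefect, leftTerm_eq_sum (N := 0) fun j _ => h.creatI_nonneg w _ (by omega),
    rightTerm_eq_sum (N := 1) fun j _ => h.creatY_nonneg u _ (by omega), sum_range_zero,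
    sum_range_one, iterTerm]
  simp only [Ring.choose_neg_one, Nat.cast_zero, add_zero, sub_zero, zero_add, h.creatY,
    h.skew_symmetry u w r, pow_zero, Ring.choose_zero_right, mul_one, smul_smul]
  rw [mul_neg, ← Units.val_mul, ← Int.negOnePow_add, ← two_mul, Int.negOnePow_two_mul]
  simp

/-- As the defect vanishes at $p=0$, multiplication by $z_1-z_2$ trades a step in `q` for a step in
`r`, so the case $q=0$ for all `r` suffices. -/
theorem jacobiDefect_vac_neg_one_left (u : V) (w : W) (q r : ℤ) :
    jacobiDefect Y YW I u w vac (-1) q r = 0 := by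
  have hs : ∀ q r, jacobiDefect Y YW I u w vac (-1) (q + 1) r =
      -jacobiDefect Y YW I u w vac (-1) q (r + 1) := fun q r => by
    rw [← h.jacobiDefect_shift, neg_add_cancel, h.jacobiDefect_vac_of_nonneg_left u w le_rfl,
      zero_sub, neg_neg]
  induction q using Int.induction_on generalizing r with
  | zero => exact h.jacobiDefect_vac_neg_one_zero u w r
  | succ q ih => rw [hs, ih, neg_zero]
  | pred q ih =>
    have := hs (-(q : ℤ) - 1) (r - 1)
    rw [sub_add_cancel, sub_add_cancel, ih] at this
    exact neg_eq_zero.1 this.symm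

/-- Descent in `p` by the translation recursion, whose coefficient $-p$ is nonzero for $p<0$. -/
theorem jacobiDefect_vac (u : V) (w : W) (p q r : ℤ) :
    jacobiDefect Y YW I u w vac p q r = 0 := by
  rcases le_or_gt 0 p with hp | hp
  · exact h.jacobiDefect_vac_of_nonneg_left u w hp q r
  obtain ⟨n, rfl⟩ : ∃ n : ℕ, p = -1 - n := ⟨(-1 - p).toNat, by omega⟩
  clear hp
  induction n generalizing q with
  | zero => simpa using h.jacobiDefect_vac_neg_one_left u w q r
  | succ n ih =>
    have h1 := h.jacobiDefect_transl u w (-1 - n) q r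
    rw [ih, ih, map_zero, smul_zero, add_zero] at h1
    have h3 := eq_zero_of_zsmul (by omega) h1.symm
    rwa [show -1 - ((n + 1 : ℕ) : ℤ) = -1 - (n : ℤ) - 1 by push_cast; ring]

theorem jacobiDefect_eq_zero (u : V) (w : W) (v : V) (p q r : ℤ) :
    jacobiDefect Y YW I u w v p q r = 0 := by
  revert u w p q r
  refine h.generated (fun v => ∀ u w p q r, jacobiDefect Y YW I u w v p q r = 0) ?_ ?_ ?_ ?_ v
  · exact h.jacobiDefect_vac
  · intro v v' hv hv' u w p q r
    -- A common truncation for `v` and `v'` replaces the `finsum`s by finite sums over the same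
    -- ranges, where additivity is clear.
    obtain ⟨N, hN⟩ := (((h.truncI.eventually w v q).and (h.truncI.eventually w v' q)).and
      ((h.truncY.eventually u v p).and (h.truncY.eventually u v' p))).exists_forall_of_atTop
    obtain ⟨M, hM⟩ := (h.truncYW.eventually u w r).exists_forall_of_atTop
    have h1 := hv u w p q r
    have h2 := hv' u w p q r
    rw [jacobiDefect, leftTerm_eq_sum fun j hj => (hN j hj).1.1,
      rightTerm_eq_sum fun j hj => (hN j hj).2.1, iterTerm_eq_sum hM] at h1
    rw [jacobiDefect, leftTerm_eq_sum fun j hj => (hN j hj).1.2,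
      rightTerm_eq_sum fun j hj => (hN j hj).2.2, iterTerm_eq_sum hM] at h2
    rw [jacobiDefect, leftTerm_eq_sum (N := N) fun j hj => by simp [hN j hj],
      rightTerm_eq_sum (N := N) fun j hj => by simp [hN j hj], iterTerm_eq_sum hM]
    simp only [map_add, smul_add, sum_add_distrib]
    rw [← add_zero (0 : W), ← congrArg₂ (· + ·) h1 h2]
    abel
  · intro c v hv u w p q r
    obtain ⟨N, hN⟩ := ((h.truncI.eventually w v q).and
      (h.truncY.eventually u v p)).exists_forall_of_atTop
    obtain ⟨M, hM⟩ := (h.truncYW.eventually u w r).exists_forall_of_atTop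
    have h1 := hv u w p q r
    rw [jacobiDefect, leftTerm_eq_sum fun j hj => (hN j hj).1,
      rightTerm_eq_sum fun j hj => (hN j hj).2, iterTerm_eq_sum hM] at h1
    rw [jacobiDefect, leftTerm_eq_sum (N := N) fun j hj => by simp [hN j hj],
      rightTerm_eq_sum (N := N) fun j hj => by simp [hN j hj], iterTerm_eq_sum hM]
    simp only [map_smul, smul_comm _ c, ← smul_sum, ← smul_sub]
    rw [h1, smul_zero]
  · intro i s v hv u w p q r
    obtain ⟨K, hK⟩ := (h.truncV i u).exists_forall_of_atTop
    obtain ⟨K', hK'⟩ := (h.truncW i w).exists_forall_of_atTop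
    -- Every term other than the defect at $a(-s-1)v$ is a defect at `v` and vanishes by induction.
    have := jacobiDefect_covariant h.covY h.covYW h.covI h.truncY h.truncYW h.truncI h.truncW i
      (-(s : ℤ) - 1) u w v p q r hK hK'
    simp only [hv, map_zero, smul_zero, sum_const_zero, add_zero] at this
    exact this.symm

end FreelyGenerated

end Vacuum

namespace Heisenberg

noncomputable section

variable {l : ℕ}

/-! ### Heisenberg modes -/

theorem mode_neg_succ (β : Fin l → ℂ) (i : Fin l) (k : ℕ) (v : Fock l) :
    mode β i (-(k : ℤ) - 1) v = MvPolynomial.X (i, k) * v := by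
  rw [show -(k : ℤ) - 1 = Int.negSucc k by rw [Int.negSucc_eq]; ring]
  rfl

theorem mode_zero (β : Fin l → ℂ) (i : Fin l) (v : Fock l) : mode β i 0 v = β i • v := rfl

theorem mode_succ (β : Fin l → ℂ) (i : Fin l) (k : ℕ) (v : Fock l) :
    mode β i ((k : ℤ) + 1) v = ((k : ℂ) + 1) • MvPolynomial.pderiv (i, k) v := rfl

theorem mode_eq_add (β : Fin l → ℂ) (i : Fin l) (n : ℤ) (v : Fock l) :
    mode β i n v = mode 0 i n v + (if n = 0 then β i else 0) • v := by
  rcases n with (_ | k) | k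
  · change β i • v = (0 : ℂ) • v + (if (0 : ℤ) = 0 then β i else 0) • v
    simp
  · rw [if_neg (by simp; omega), zero_smul, add_zero]
    rfl
  · rw [if_neg (by simp), zero_smul, add_zero]
    rfl

theorem mode_one (i : Fin l) {n : ℤ} (hn : 0 ≤ n) : mode 0 i n (1 : Fock l) = 0 := by
  obtain ⟨n, rfl⟩ := Int.eq_ofNat_of_zero_le hn
  rcases n with _ | k
  · exact zero_smul ℂ (1 : Fock l)
  · change mode 0 i ((k + 1 : ℕ) : ℤ) 1 = 0
    push_cast
    rw [mode_succ]
    simp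

theorem mode_pos_X_mul (β : Fin l → ℂ) (i j : Fin l) (n k : ℕ) (v : Fock l) :
    mode β i ((n : ℤ) + 1) (MvPolynomial.X (j, k) * v) =
      MvPolynomial.X (j, k) * mode β i ((n : ℤ) + 1) v +
        (if i = j ∧ n = k then (n : ℤ) + 1 else 0) • v := by
  rw [mode_succ, mode_succ, Derivation.leibniz, MvPolynomial.pderiv_X, Pi.single_apply]
  by_cases h : i = j ∧ n = k
  · obtain ⟨rfl, rfl⟩ := h
    simp only [and_self, if_true, smul_eq_mul, mul_one, smul_add, mul_smul_comm]
    congr 1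
    rw [← Int.cast_smul_eq_zsmul ℂ]
    push_cast
    rfl
  · rw [if_neg h, if_neg (by rintro h'; simp at h'; exact h ⟨h'.1.symm, h'.2.symm⟩)]
    simp

theorem mode_commutator (β : Fin l → ℂ) (i j : Fin l) (n m : ℤ) (v : Fock l) :
    mode β i n (mode β j m v) =
      mode β j m (mode β i n v) + (if i = j ∧ n = -m then n else 0) • v := by
  rcases lt_trichotomy n 0 with hn | rfl | hn
  · obtain ⟨n, rfl⟩ : ∃ k : ℕ, n = -(k : ℤ) - 1 := ⟨(-1 - n).toNat, by omega⟩
    rcases lt_trichotomy m 0 with hm | rfl | hm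
    · obtain ⟨m, rfl⟩ : ∃ k : ℕ, m = -(k : ℤ) - 1 := ⟨(-1 - m).toNat, by omega⟩
      rw [if_neg (by omega), zero_smul, add_zero]
      simp only [mode_neg_succ]
      ring
    · rw [if_neg (by omega), zero_smul, add_zero, mode_zero, mode_zero, map_smul]
    · obtain ⟨m, rfl⟩ : ∃ k : ℕ, m = (k : ℤ) + 1 := ⟨(m - 1).toNat, by omega⟩
      rw [mode_neg_succ, mode_neg_succ, mode_pos_X_mul, add_assoc, ← add_smul]
      by_cases h : i = j ∧ n = m
      · obtain ⟨rfl, rfl⟩ := h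
        rw [if_pos ⟨rfl, rfl⟩, if_pos ⟨rfl, by ring⟩, show (n : ℤ) + 1 + (-n - 1) = 0 by ring,
          zero_smul, add_zero]
      · rw [if_neg (by rintro ⟨h1, h2⟩; exact h ⟨h1.symm, h2.symm⟩),
          if_neg (by rintro ⟨h1, h2⟩; exact h ⟨h1, by omega⟩)]
        simp
  · simp [mode_zero]
  · rcases lt_or_ge m 0 with hm | hm
    · obtain ⟨m, rfl⟩ : ∃ k : ℕ, m = -(k : ℤ) - 1 := ⟨(-1 - m).toNat, by omega⟩
      obtain ⟨n, rfl⟩ : ∃ k : ℕ, n = (k : ℤ) + 1 := ⟨(n - 1).toNat, by omega⟩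
      rw [mode_neg_succ, mode_neg_succ, mode_pos_X_mul]
      congr 2
      refine if_congr ?_ rfl rfl
      constructor <;> rintro ⟨h1, h2⟩ <;> exact ⟨h1, by omega⟩
    · rw [if_neg (by omega), zero_smul, add_zero]
      lift n to ℕ using hn.le
      lift m to ℕ using hm
      exact mode_comm β i j n m v

theorem eventually_mode_eq_zero (β : Fin l → ℂ) (i : Fin l) (v : Fock l) :
    ∀ᶠ k : ℕ in atTop, mode β i k v = 0 := by
  obtain ⟨N, hN⟩ := exists_mode_eq_zero β v
  filter_upwards [eventually_ge_atTop N] with k hk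
  exact hN i k hk

theorem fock_induction {P : Fock l → Prop} (one : P 1) (add : ∀ u v, P u → P v → P (u + v))
    (smul : ∀ (c : ℂ) u, P u → P (c • u)) (X_mul : ∀ x u, P u → P (MvPolynomial.X x * u))
    (u : Fock l) : P u := by
  induction u using MvPolynomial.induction_on with
  | C a =>
    rw [← mul_one (MvPolynomial.C a), ← MvPolynomial.smul_eq_C_mul]
    exact smul a 1 one
  | add p q hp hq => exact add p q hp hq
  | mul_X p x hp => rw [mul_comm]; exact X_mul x p hp

/-! ### Operations on fields -/

theorem field_ext {A B : FockField l} (h : ∀ v t, (A v).coeff t = (B v).coeff t) : A = B :=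
  LinearMap.ext fun v => HahnSeries.ext (funext (h v))

/-- The field `z^m A(z)`. -/
def shift (m : ℤ) : FockField l →ₗ[ℂ] FockField l where
  toFun A :=
    { toFun := fun v => HahnSeries.single m (1 : Fock l) * A v
      map_add' := fun v w => by rw [map_add, mul_add]
      map_smul' := fun c v => by
        ext1
        funext t
        simp [HahnSeries.coeff_single_mul] }
  map_add' A B := LinearMap.ext fun v => by simp [mul_add]
  map_smul' c A := field_ext fun v t => by simp [HahnSeries.coeff_single_mul]

@[simp]
theorem shift_coeff (m : ℤ) (A : FockField l) (v : Fock l) (t : ℤ) :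
    (shift m A v).coeff t = (A v).coeff (t - m) := by
  simp [shift, HahnSeries.coeff_single_mul]

/-- The field `T A(z) - A(z) T'`. -/
def ad (T T' : Module.End ℂ (Fock l)) : FockField l →ₗ[ℂ] FockField l where
  toFun A :=
    { toFun := fun v => (A v).map T - A (T' v)
      map_add' := fun v w => by
        ext1
        funext t
        simp [add_sub_add_comm]
      map_smul' := fun c v => by
        ext1
        funext t
        simp [smul_sub] }
  map_add' A B := field_ext fun v t => by simp [add_sub_add_comm]
  map_smul' c A := field_ext fun v t => by simp [smul_sub]

@[simp]
theorem ad_coeff (T T' : Module.End ℂ (Fock l)) (A : FockField l) (v : Fock l) (t : ℤ) :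
    (ad T T' A v).coeff t = T ((A v).coeff t) - (A (T' v)).coeff t := by
  simp [ad]

/-- The field `∂_z A(z)`. -/
def fieldDeriv : FockField l →ₗ[ℂ] FockField l where
  toFun A := LaurentSeries.derivative ℂ ∘ₗ A
  map_add' A B := LinearMap.ext fun v => by simp
  map_smul' c A := LinearMap.ext fun v => by simp

@[simp]
theorem fieldDeriv_coeff (A : FockField l) (v : Fock l) (t : ℤ) :
    (fieldDeriv A v).coeff t = (t + 1) • (A v).coeff (t + 1) := by
  simp [fieldDeriv]

theorem eventually_coeff_eq_zero (f : LaurentSeries (Fock l)) (t : ℤ) :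
    ∀ᶠ j : ℕ in atTop, f.coeff (t - j) = 0 := by
  filter_upwards [eventually_gt_atTop (t - f.order).toNat] with j hj
  exact HahnSeries.coeff_eq_zero_of_lt_order (by omega)

/-- Replaces the convolution over supports of Hahn series by a sum over the power series index, cut
off by the lower truncation of `f`. -/
theorem ofPowerSeries_mul_coeff {g : ℕ → Fock l} {f : LaurentSeries (Fock l)} {t : ℤ} {J : ℕ}
    (hJ : ∀ j : ℕ, J ≤ j → f.coeff (t - j) = 0) :
    (HahnSeries.ofPowerSeries ℤ (Fock l) (PowerSeries.mk g) * f).coeff t =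
      ∑ j ∈ range J, g j * f.coeff (t - j) := by
  have h0 : ∀ n : ℕ, (HahnSeries.ofPowerSeries ℤ (Fock l) (PowerSeries.mk g)).coeff n = g n :=
    fun n => by rw [HahnSeries.ofPowerSeries_apply_coeff, PowerSeries.coeff_mk]
  have h1 : ∀ n : ℤ, n < 0 →
      (HahnSeries.ofPowerSeries ℤ (Fock l) (PowerSeries.mk g)).coeff n = 0 := by
    intro n hn
    rw [HahnSeries.ofPowerSeries_apply]
    refine HahnSeries.embDomain_of_notMem_range ?_
    rintro ⟨m, hm⟩
    have : (m : ℤ) = n := hm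
    omega
  rw [HahnSeries.coeff_mul]
  symm
  have h2 : ∑ j ∈ range J, g j * f.coeff (t - j) =
      ∑ x ∈ (range J).image (fun j : ℕ => ((j : ℤ), t - (j : ℤ))),
        (HahnSeries.ofPowerSeries ℤ (Fock l) (PowerSeries.mk g)).coeff x.1 * f.coeff x.2 := by
    rw [sum_image]
    · exact sum_congr rfl fun j _ => by rw [h0]
    · intro a _ b _ hab
      simpa using hab
  rw [h2]
  symm
  refine sum_subset ?_ ?_
  · rintro ⟨a, b⟩ hab
    simp only [Finset.mem_antidiagonal, HahnSeries.mem_support] at hab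
    obtain ⟨ha, hb, hab⟩ := hab
    have ha' : 0 ≤ a := not_lt.1 fun h => ha (h1 a h)
    lift a to ℕ using ha'
    simp only [mem_image, mem_range, Prod.mk.injEq]
    refine ⟨a, ?_, rfl, by omega⟩
    by_contra h
    exact hb (by rw [show b = t - a by omega]; exact hJ a (by omega))
  · rintro ⟨a, b⟩ hab hn
    simp only [mem_image, mem_range, Prod.mk.injEq] at hab
    obtain ⟨j, _, rfl, rfl⟩ := hab
    by_contra h
    refine hn ?_
    simp only [Finset.mem_antidiagonal, HahnSeries.mem_support]
    exact ⟨left_ne_zero_of_mul h, right_ne_zero_of_mul h, by ring⟩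

theorem normalMul_coeff (β : Fin l → ℂ) (x : Fin l × ℕ) (A : FockField l) (v : Fock l) (t : ℤ)
    {J N : ℕ} (hJ : ∀ j : ℕ, J ≤ j → (A v).coeff (t - j) = 0)
    (hN : ∀ n : ℕ, N ≤ n → mode β x.1 n v = 0) :
    (normalMul β x A v).coeff t =
      ∑ j ∈ range J, ((j + x.2).choose x.2 : ℤ) •
        (MvPolynomial.X (x.1, j + x.2) * (A v).coeff (t - j)) +
      ∑ n ∈ range N, Ring.choose (-(n : ℤ) - 1) x.2 •
        (A (mode β x.1 n v)).coeff (t + n + 1 + x.2) := by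
  rw [normalMul_eq_sum β x A v N hN, HahnSeries.coeff_add, creationPart,
    ofPowerSeries_mul_coeff hJ, HahnSeries.coeff_sum]
  congr 1
  · refine sum_congr rfl fun j _ => ?_
    rw [mul_assoc, zsmul_eq_mul, Int.cast_natCast]
  · refine sum_congr rfl fun n _ => ?_
    rw [annihilationCoeff, HahnSeries.coeff_single_mul, zsmul_eq_mul]
    congr 2
    ring

theorem eventually_normal (β : Fin l → ℂ) (i : Fin l) (A : FockField l) (v : Fock l) (t : ℤ) :
    ∀ᶠ N : ℕ in atTop, (∀ j : ℕ, N ≤ j → (A v).coeff (t - j) = 0) ∧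
      ∀ n : ℕ, N ≤ n → mode β i n v = 0 := by
  obtain ⟨N, hN⟩ := ((eventually_coeff_eq_zero (A v) t).and
    (eventually_mode_eq_zero β i v)).exists_forall_of_atTop
  filter_upwards [eventually_ge_atTop N] with M hM
  exact ⟨fun j hj => (hN j (hM.trans hj)).1, fun j hj => (hN j (hM.trans hj)).2⟩

/-- `normalMul` as a linear map in the field. -/
def normalMulHom (β : Fin l → ℂ) (x : Fin l × ℕ) : FockField l →ₗ[ℂ] FockField l where
  toFun := normalMul β x
  map_add' A B := field_ext fun v t => by
    obtain ⟨N, h1, h2, h3⟩ := ((eventually_normal β x.1 A v t).and ((eventually_normal β x.1 B v t).and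
      (eventually_normal β x.1 (A + B) v t))).exists
    rw [LinearMap.add_apply, HahnSeries.coeff_add, normalMul_coeff β x A v t h1.1 h1.2,
      normalMul_coeff β x B v t h2.1 h2.2, normalMul_coeff β x (A + B) v t h3.1 h3.2]
    simp only [LinearMap.add_apply, HahnSeries.coeff_add, mul_add, smul_add, sum_add_distrib]
    abel
  map_smul' c A := field_ext fun v t => by
    obtain ⟨N, h1, h2⟩ := ((eventually_normal β x.1 A v t).and
      (eventually_normal β x.1 (c • A) v t)).exists
    rw [RingHom.id_apply, LinearMap.smul_apply, HahnSeries.coeff_smul,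
      normalMul_coeff β x A v t h1.1 h1.2, normalMul_coeff β x (c • A) v t h2.1 h2.2]
    simp only [LinearMap.smul_apply, HahnSeries.coeff_smul, mul_smul_comm, smul_comm _ c, smul_add,
      smul_sum]

@[simp]
theorem normalMulHom_apply (β : Fin l → ℂ) (x : Fin l × ℕ) (A : FockField l) :
    normalMulHom β x A = normalMul β x A := rfl

theorem normalMul_shift (β : Fin l → ℂ) (x : Fin l × ℕ) (m : ℤ) (A : FockField l) :
    normalMul β x (shift m A) = shift m (normalMul β x A) := by
  refine field_ext fun v t => ?_
  obtain ⟨N, h1, h2⟩ := ((eventually_normal β x.1 (shift m A) v t).and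
    (eventually_normal β x.1 A v (t - m))).exists
  rw [shift_coeff, normalMul_coeff β x _ v t h1.1 h1.2, normalMul_coeff β x A v (t - m) h2.1 h2.2]
  simp only [shift_coeff]
  congr 1
  · exact sum_congr rfl fun j _ => by rw [sub_right_comm]
  · exact sum_congr rfl fun j _ => by
      rw [show t + j + 1 + x.2 - m = t - m + j + 1 + x.2 by ring]

/-- A mode passes through a normally ordered product by Leibniz; the first summand is the
contraction $[a^i(n),\frac1{s!}\partial_z^sa^j(z)]=\delta_{ij}\,n\binom{n-1}s z^{n-1-s}$. The
parameters `γ` and `β` are the zero modes on target and source. -/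
theorem ad_mode_normalMul (γ β : Fin l → ℂ) (i : Fin l) (n : ℤ) (x : Fin l × ℕ)
    (A : FockField l) :
    ad (mode γ i n) (mode β i n) (normalMul β x A) =
      (if i = x.1 then n * Ring.choose (n - 1) x.2 else 0) • shift (n - 1 - x.2) A +
        normalMul β x (ad (mode γ i n) (mode β i n) A) := by
  obtain ⟨j, s⟩ := x
  refine field_ext fun v t => ?_
  obtain ⟨N, ⟨h1, h2, h3⟩, h4⟩ := (((eventually_normal β j A v t).and
    ((eventually_normal β j A (mode β i n v) t).and
    (eventually_normal β j (ad (mode γ i n) (mode β i n) A) v t))).and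
    (eventually_gt_atTop n.natAbs)).exists
  simp only [ad_coeff, LinearMap.add_apply, HahnSeries.coeff_add, LinearMap.smul_apply,
    HahnSeries.coeff_smul, shift_coeff]
  rw [normalMul_coeff β (j, s) A v t h1.1 h1.2, normalMul_coeff β (j, s) A _ t h2.1 h2.2,
    normalMul_coeff β (j, s) (ad (mode γ i n) (mode β i n) A) v t h3.1 h3.2]
  simp only [ad_coeff, map_add, map_sum, map_zsmul]
  have hX : ∀ k : ℕ, mode γ i n (MvPolynomial.X (j, k + s) * (A v).coeff (t - k)) =
      MvPolynomial.X (j, k + s) * mode γ i n ((A v).coeff (t - k)) +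
        (if i = j ∧ n = k + s + 1 then n else 0) • (A v).coeff (t - k) := by
    intro k
    rw [← mode_neg_succ γ, mode_commutator, mode_neg_succ]
    congr 2
    refine if_congr ?_ rfl rfl
    push_cast
    constructor <;> rintro ⟨h, h'⟩ <;> exact ⟨h, by omega⟩
  have hA : ∀ k : ℕ, (A (mode β j k (mode β i n v))).coeff (t + k + 1 + s) =
      (A (mode β i n (mode β j k v))).coeff (t + k + 1 + s) -
        (if i = j ∧ n = -k then n else 0) • (A v).coeff (t + k + 1 + s) := by
    intro k
    rw [mode_commutator β i j n k v, map_add, map_zsmul, HahnSeries.coeff_add,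
      HahnSeries.coeff_smul, add_sub_cancel_right]
  simp only [hX, hA, smul_add, smul_sub, sum_add_distrib, sum_sub_distrib, mul_sub]
  have key : ∑ k ∈ range N, ((k + s).choose s : ℤ) •
        (if i = j ∧ n = k + s + 1 then n else 0) • (A v).coeff (t - k) +
      ∑ k ∈ range N, Ring.choose (-(k : ℤ) - 1) s •
        (if i = j ∧ n = -k then n else 0) • (A v).coeff (t + k + 1 + s) =
      (if i = j then n * Ring.choose (n - 1) s else 0) • (A v).coeff (t - (n - 1 - s)) := by
    by_cases hij : i = j
    · simp only [hij, true_and, if_true]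
      -- For $n\le0$ the contraction comes from the annihilation mode $k=-n$, for $n>0$ from the
      -- creation term $k=n-1-s$.
      rcases le_or_gt n 0 with hn | hn
      · rw [sum_eq_zero fun k _ => by rw [if_neg (by omega), zero_smul, smul_zero], zero_add,
          sum_eq_single_of_mem (-n).toNat (mem_range.2 (by omega))]
        · rw [if_pos (by omega), smul_smul, mul_comm]
          have : (((-n).toNat : ℕ) : ℤ) = -n := by omega
          rw [this, neg_neg, show t + -n + 1 + s = t - (n - 1 - s) by ring]
        · intro k _ hk
          rw [if_neg (by omega), zero_smul, smul_zero]
      · rw [add_comm, sum_eq_zero fun k _ => by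
          by_cases h : n = -(k : ℤ)
          · omega
          · rw [if_neg h, zero_smul, smul_zero], zero_add]
        obtain ⟨m, rfl⟩ : ∃ m : ℕ, n = m + 1 := ⟨(n - 1).toNat, by omega⟩
        rw [add_sub_cancel_right, Ring.choose_natCast]
        by_cases hms : s ≤ m
        · rw [sum_eq_single_of_mem (m - s) (mem_range.2 (by omega))]
          · rw [if_pos (by omega), smul_smul, mul_comm, Nat.sub_add_cancel hms]
            push_cast [hms]
            rfl
          · intro k _ hk
            rw [if_neg (by omega), zero_smul, smul_zero]
        · rw [Nat.choose_eq_zero_of_lt (by omega), sum_eq_zero fun k _ => by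
            rw [if_neg (by omega), zero_smul, smul_zero]]
          simp
    · simp [hij]
  rw [← key]
  abel

/-! ### Fields generated by normally ordered products -/

/-- The identity field. -/
def idField : FockField l where
  toFun := fun v => HahnSeries.single 0 v
  map_add' := fun v w => by simp
  map_smul' := fun c v => by
    ext n
    by_cases h : n = 0 <;> simp [h]

theorem idField_coeff (v : Fock l) (t : ℤ) :
    (idField v).coeff t = if t = 0 then v else 0 := by
  change (HahnSeries.single 0 v).coeff t = _
  by_cases h : t = 0 <;> simp [h]

/-- The family of fields obtained from `B` by normally ordered multiplication with derivatives of
the `a^i(z)`. -/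
def fieldOf (β : Fin l → ℂ) (B : FockField l) : Fock l →ₗ[ℂ] FockField l :=
  (MvPolynomial.basisMonomials (Fin l × ℕ) ℂ).constr ℂ fun m =>
    (Finsupp.toMultiset m).foldr (normalMul β) B

theorem vertexField_eq (β : Fin l → ℂ) : vertexField β = fieldOf β idField := rfl

theorem fieldOf_monomial (β : Fin l → ℂ) (B : FockField l) (m : Fin l × ℕ →₀ ℕ) :
    fieldOf β B (MvPolynomial.monomial m 1) = (Finsupp.toMultiset m).foldr (normalMul β) B := by
  have h : MvPolynomial.monomial m (1 : ℂ) = MvPolynomial.basisMonomials (Fin l × ℕ) ℂ m := by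
    rw [MvPolynomial.coe_basisMonomials]
  rw [h, fieldOf, Module.Basis.constr_basis]

theorem fieldOf_one (β : Fin l → ℂ) (B : FockField l) : fieldOf β B 1 = B := by
  have h := fieldOf_monomial β B 0
  rwa [map_zero, Multiset.foldr_zero] at h

/-- Extends the recursion from monomials to all vectors; every property of `fieldOf` below is an
induction along it. -/
theorem fieldOf_X_mul (β : Fin l → ℂ) (B : FockField l) (x : Fin l × ℕ) (w : Fock l) :
    fieldOf β B (MvPolynomial.X x * w) = normalMul β x (fieldOf β B w) := by
  have : fieldOf β B ∘ₗ LinearMap.mulLeft ℂ (MvPolynomial.X x) =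
      normalMulHom β x ∘ₗ fieldOf β B := by
    refine (MvPolynomial.basisMonomials (Fin l × ℕ) ℂ).ext fun m => ?_
    rw [MvPolynomial.coe_basisMonomials]
    simp only [LinearMap.comp_apply, LinearMap.mulLeft_apply, normalMulHom_apply]
    rw [fieldOf_monomial, MvPolynomial.X, MvPolynomial.monomial_mul, one_mul, fieldOf_monomial,
      map_add, Finsupp.toMultiset_single, one_smul, Multiset.singleton_add, Multiset.foldr_cons]
  exact LinearMap.congr_fun this w

theorem mode_X_mul (β : Fin l → ℂ) (i : Fin l) (n : ℤ) (x : Fin l × ℕ) (w : Fock l) :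
    mode β i n (MvPolynomial.X x * w) =
      MvPolynomial.X x * mode β i n w + (if i = x.1 ∧ n = x.2 + 1 then n else 0) • w := by
  obtain ⟨j, s⟩ := x
  rw [← mode_neg_succ β, mode_commutator, mode_neg_succ]
  congr 2
  refine if_congr ?_ rfl rfl
  constructor <;> rintro ⟨h, h'⟩ <;> exact ⟨h, by omega⟩

/-- The seed behaves like a vector on which $a^i(0)$ is the scalar $\delta_i$ and positive modes
vanish, so the fields built from it are labelled by $M_\delta$. The contraction with $X_{(i,s)}$ is
the $k=s+1$ term, as $(s+1)\binom n{s+1}=n\binom{n-1}s$. -/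
theorem ad_mode_fieldOf {γ β δ : Fin l → ℂ} {B : FockField l}
    (hB : ∀ i n, ad (mode γ i n) (mode β i n) B = δ i • shift n B) (i : Fin l) (n : ℤ)
    (w : Fock l) {K : ℕ} (hK : ∀ k : ℕ, K ≤ k → mode δ i k w = 0) :
    ad (mode γ i n) (mode β i n) (fieldOf β B w) =
      ∑ k ∈ range K, Ring.choose n k • shift (n - k) (fieldOf β B (mode δ i k w)) := by
  -- The sum is independent of the cutoff once it is large, and an eventual statement lets each
  -- induction step enlarge it.
  suffices h : ∀ᶠ K : ℕ in atTop, ad (mode γ i n) (mode β i n) (fieldOf β B w) =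
      ∑ k ∈ range K, Ring.choose n k • shift (n - k) (fieldOf β B (mode δ i k w)) by
    obtain ⟨K', h1, h2⟩ := (h.and (eventually_ge_atTop K)).exists
    rw [h1]
    refine sum_range_eq_sum_range (fun k hk => ?_) (fun k hk => ?_) <;>
    · rw [hK k (by omega), map_zero, map_zero, smul_zero]
  clear hK K
  induction w using fock_induction with
  | one =>
    filter_upwards [eventually_ge_atTop 1] with K hK
    rw [fieldOf_one, hB, sum_eq_single_of_mem 0 (by simp; omega)]
    · rw [Nat.cast_zero, mode_zero, map_smul, fieldOf_one, Ring.choose_zero_right, one_smul,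
        map_smul, sub_zero]
    · intro k _ hk
      rw [mode_eq_add, mode_one i (by omega), if_neg (by omega)]
      simp
  | add u v hu hv =>
    filter_upwards [hu, hv] with K h1 h2
    simp only [map_add, h1, h2, smul_add, sum_add_distrib]
  | smul c u hu =>
    filter_upwards [hu] with K h1
    simp only [map_smul, h1, smul_sum, smul_comm c]
  | X_mul x w ih =>
    filter_upwards [ih, eventually_gt_atTop (x.2 + 1)] with K h1 hK
    rw [fieldOf_X_mul, ad_mode_normalMul, h1, ← normalMulHom_apply, map_sum]
    simp only [mode_X_mul, map_add, map_zsmul, smul_add, sum_add_distrib, fieldOf_X_mul,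
      normalMulHom_apply, normalMul_shift]
    rw [add_comm]
    congr 1
    rw [sum_eq_single_of_mem (x.2 + 1) (by simpa using hK)]
    · by_cases h : i = x.1
      · rw [if_pos h, if_pos ⟨h, by push_cast; rfl⟩, smul_smul, ← Ring.choose_succ_mul, mul_comm]
        push_cast
        rw [sub_sub, add_comm (1 : ℤ)]
      · rw [if_neg h, if_neg (by tauto)]
        simp
    · intro k _ hk
      rw [if_neg (by omega), zero_smul, smul_zero]

/-- The modes of a family of fields. -/
def modesOf (F : Fock l →ₗ[ℂ] FockField l) : Fock l →ₗ[ℂ] (ℤ → (Fock l →ₗ[ℂ] Fock l)) where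
  toFun u n :=
    { toFun := fun v => (F u v).coeff (-n - 1)
      map_add' := fun v w => by simp
      map_smul' := fun c v => by simp }
  map_add' u w := funext fun n => LinearMap.ext fun v => by simp
  map_smul' c u := funext fun n => LinearMap.ext fun v => by simp

theorem modesOf_apply (F : Fock l →ₗ[ℂ] FockField l) (u : Fock l) (n : ℤ) (v : Fock l) :
    modesOf F u n v = (F u v).coeff (-n - 1) := rfl

theorem vertexModes_eq (β : Fin l → ℂ) : vertexModes β = modesOf (fieldOf β idField) := rfl

theorem modesOf_truncated (F : Fock l →ₗ[ℂ] FockField l) : ModeTruncated (modesOf F) := by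
  intro u v
  refine ⟨-(F u v).order, fun n hn => ?_⟩
  rw [modesOf_apply]
  exact HahnSeries.coeff_eq_zero_of_lt_order (by omega)

theorem modesOf_covariant {γ β δ : Fin l → ℂ} {B : FockField l}
    (hB : ∀ i n, ad (mode γ i n) (mode β i n) B = δ i • shift n B) :
    ModeCovariant (mode δ) (mode β) (mode γ) (modesOf (fieldOf β B)) := by
  intro i n m w v K hK
  have h := congrArg (fun A : FockField l => (A v).coeff (-m - 1)) (ad_mode_fieldOf hB i n w hK)
  simp only [ad_coeff, LinearMap.sum_apply, HahnSeries.coeff_sum, LinearMap.smul_apply,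
    HahnSeries.coeff_smul, shift_coeff] at h
  rw [sub_eq_iff_eq_add'] at h
  simp only [modesOf_apply]
  refine h.trans ?_
  congr 1
  refine sum_congr rfl fun k _ => ?_
  rw [show -m - 1 - (n - (k : ℤ)) = -(n + m - k) - 1 by ring]

theorem ad_mode_idField (γ : Fin l → ℂ) (i : Fin l) (n : ℤ) :
    ad (mode γ i n) (mode γ i n) idField = (0 : Fin l → ℂ) i • shift n idField := by
  refine field_ext fun v t => ?_
  simp only [ad_coeff, idField_coeff]
  by_cases h : t = 0 <;> simp [h]

theorem modesOf_X_mul (β : Fin l → ℂ) (B : FockField l) (i : Fin l) (s : ℕ) (u : Fock l) (n : ℤ)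
    (w : Fock l) (J K : ℕ) (hJ : ∀ m : ℕ, J ≤ m → modesOf (fieldOf β B) u (n + m) w = 0)
    (hK : ∀ k : ℕ, K ≤ k → mode β i k w = 0) :
    modesOf (fieldOf β B) (MvPolynomial.X (i, s) * u) n w =
      ∑ m ∈ range J, ((m + s).choose s : ℤ) •
        (MvPolynomial.X (i, m + s) * modesOf (fieldOf β B) u (n + m) w) +
      ∑ k ∈ range K, Ring.choose (-(k : ℤ) - 1) s •
        modesOf (fieldOf β B) u (n - k - 1 - s) (mode β i k w) := by
  rw [modesOf_apply, fieldOf_X_mul, normalMul_coeff β (i, s) _ w _ (J := J) (N := K) _ hK]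
  · refine congrArg₂ (· + ·) ?_ ?_
    · refine sum_congr rfl fun m _ => ?_
      rw [modesOf_apply, show -(n + (m : ℤ)) - 1 = -n - 1 - m by ring]
    · refine sum_congr rfl fun k _ => ?_
      rw [modesOf_apply, show -n - 1 + (k : ℤ) + 1 + s = -(n - k - 1 - s) - 1 by ring]
  · intro j hj
    have := hJ j hj
    rwa [modesOf_apply, show -(n + (j : ℤ)) - 1 = -n - 1 - j by ring] at this

theorem vertexModes_one (β : Fin l → ℂ) (n : ℤ) (w : Fock l) :
    vertexModes β 1 n w = if n = -1 then w else 0 := by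
  rw [vertexModes_eq, modesOf_apply, fieldOf_one, idField_coeff]
  exact if_congr (by omega) rfl rfl

/-- The operator of $a^i(-1)\mathbf 1$ is $a^i(z)$; this is how the axioms on vertex operators give
access to the Heisenberg modes. -/
theorem vertexModes_X (β : Fin l → ℂ) (i : Fin l) (n : ℤ) :
    vertexModes β (MvPolynomial.X (i, 0)) n = mode β i n := by
  refine LinearMap.ext fun v => ?_
  -- `K` exceeds $|n|$ so that the single surviving index lies in the range of either sum.
  obtain ⟨K, hK, hn⟩ := ((eventually_mode_eq_zero β i v).exists_forall_of_atTop.choose_spec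
    |> fun h => (eventually_ge_atTop _).mono fun K hK => fun k hk => h k (hK.trans hk)).and
    (eventually_gt_atTop n.natAbs) |>.exists
  have hJ : ∀ m : ℕ, K ≤ m → modesOf (fieldOf β idField) 1 (n + m) v = 0 := fun m hm => by
    rw [← vertexModes_eq, vertexModes_one, if_neg (by omega)]
  have := modesOf_X_mul β idField i 0 1 n v K K hJ hK
  rw [mul_one, ← vertexModes_eq] at this
  rw [this]
  simp only [vertexModes_one, Nat.choose_zero_right, add_zero, Ring.choose_zero_right,
    Nat.cast_one, one_smul, Nat.cast_zero, sub_zero]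
  rcases lt_or_ge n 0 with h | h
  · obtain ⟨k, rfl⟩ : ∃ k : ℕ, n = -(k : ℤ) - 1 := ⟨(-1 - n).toNat, by omega⟩
    rw [sum_eq_single_of_mem k (mem_range.2 (by omega)), if_pos (by ring), mode_neg_succ,
      sum_eq_zero, add_zero]
    · intro j _
      rw [if_neg (by omega)]
    · intro j _ hj
      rw [if_neg (by omega), mul_zero]
  · lift n to ℕ using h
    rw [add_comm, sum_eq_single_of_mem n (mem_range.2 (by omega)), if_pos (by ring),
      sum_eq_zero, add_zero]
    · intro j _
      rw [if_neg (by omega), mul_zero]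
    · intro j _ hj
      rw [if_neg (by omega)]

/-! ### The translation operator -/

/-- The translation operator `L_{M_γ}(-1)`. -/
def transl (γ : Fin l → ℂ) : Module.End ℂ (Fock l) := vertexModes γ (conformal l) 0

/-- For $a^i(-1)^2\mathbf 1$ the creation and annihilation halves contribute equally, cancelling the
$\frac12$ in $\omega$. -/
theorem transl_apply (γ : Fin l → ℂ) (v : Fock l) {N : ℕ}
    (hN : ∀ (i : Fin l) (n : ℕ), N ≤ n → mode γ i n v = 0) :
    transl γ v = ∑ i, ∑ j ∈ range N, MvPolynomial.X (i, j) * mode γ i j v := by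
  have h : ∀ i, vertexModes γ ((MvPolynomial.X (i, 0)) ^ 2) 0 v =
      (2 : ℂ) • ∑ j ∈ range N, MvPolynomial.X (i, j) * mode γ i j v := by
    intro i
    have := modesOf_X_mul γ idField i 0 (MvPolynomial.X (i, 0)) 0 v N N (fun m hm => by
      rw [← vertexModes_eq, vertexModes_X, zero_add]; exact hN i m hm) (hN i)
    rw [← sq, ← vertexModes_eq] at this
    rw [this, two_smul]
    simp only [vertexModes_X, Nat.choose_zero_right, add_zero, Ring.choose_zero_right,
      Nat.cast_one, one_smul, Nat.cast_zero, sub_zero, zero_add, zero_sub, mode_neg_succ]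
  rw [transl, conformal]
  simp only [map_smul, map_sum, Pi.smul_apply, Finset.sum_apply, LinearMap.smul_apply,
    LinearMap.sum_apply, h, ← smul_sum, smul_smul]
  norm_num

theorem transl_eq_add (γ : Fin l → ℂ) (v : Fock l) :
    transl γ v = transl 0 v + ∑ i, γ i • (MvPolynomial.X (i, 0) * v) := by
  obtain ⟨N, hN⟩ := exists_mode_eq_zero γ v
  obtain ⟨N', hN'⟩ := exists_mode_eq_zero 0 v
  rw [transl_apply γ v (N := N + N' + 1) fun i n hn => hN i n (by omega),
    transl_apply 0 v (N := N + N' + 1) fun i n hn => hN' i n (by omega), ← sum_add_distrib]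
  refine sum_congr rfl fun i _ => ?_
  simp only [mode_eq_add γ i, mul_add, sum_add_distrib]
  congr 1
  rw [sum_eq_single_of_mem 0 (by simp)]
  · simp
  · intro j _ hj
    rw [if_neg (by omega), zero_smul, mul_zero]

theorem transl_zero_one : transl 0 (1 : Fock l) = 0 := by
  rw [transl_apply 0 1 (N := 0) fun i n _ => mode_one i (by omega)]
  simp

theorem transl_one (γ : Fin l → ℂ) :
    transl γ 1 = ∑ i, γ i • (MvPolynomial.X (i, 0) : Fock l) := by
  rw [transl_eq_add, transl_zero_one, zero_add]
  simp

theorem mode_conformal (i : Fin l) (k : ℕ) :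
    mode 0 i k (conformal l) = if k = 1 then MvPolynomial.X (i, 0) else 0 := by
  have h : ∀ j, mode 0 i k ((MvPolynomial.X (j, 0) : Fock l) ^ 2) =
      if i = j ∧ k = 1 then (2 : ℂ) • MvPolynomial.X (i, 0) else 0 := by
    intro j
    rw [sq, mode_X_mul, ← mul_one (MvPolynomial.X (j, 0)), mode_X_mul, mode_one i (by omega)]
    by_cases hk : i = j ∧ k = 1
    · obtain ⟨rfl, rfl⟩ := hk
      simp [two_smul]
    · rw [if_neg (by simpa using hk), if_neg hk]
      simp
  rw [conformal, map_smul, map_sum, sum_congr rfl fun j _ => h j]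
  by_cases hk : k = 1
  · simp [hk]
  · simp [hk]

/-- The commutator formula for $\omega$: only $k=1$ contributes, because
$a^i(k)\omega=\delta_{k,1}a^i(-1)\mathbf 1$. -/
theorem mode_transl (γ : Fin l → ℂ) (i : Fin l) (n : ℤ) (w : Fock l) :
    mode γ i n (transl γ w) = transl γ (mode γ i n w) + n • mode γ i (n - 1) w := by
  have h := modesOf_covariant (ad_mode_idField γ) i n 0 (conformal l) w 2 fun k hk => by
    rw [mode_conformal, if_neg (by omega)]
  rw [← vertexModes_eq] at h
  simpa [transl, sum_range_succ, mode_conformal, vertexModes_X, Ring.choose_one_right] using h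

theorem transl_X_mul (γ : Fin l → ℂ) (x : Fin l × ℕ) (w : Fock l) :
    transl γ (MvPolynomial.X x * w) =
      MvPolynomial.X x * transl γ w + ((x.2 : ℤ) + 1) • (MvPolynomial.X (x.1, x.2 + 1) * w) := by
  have h := mode_transl γ x.1 (-(x.2 : ℤ) - 1) w
  rw [show -(x.2 : ℤ) - 1 - 1 = -((x.2 + 1 : ℕ) : ℤ) - 1 by push_cast; ring, mode_neg_succ,
    mode_neg_succ, mode_neg_succ] at h
  rw [h, add_assoc, ← add_smul]
  simp

/-- Commutation with $L(-1)$ differentiates the factor: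
$\partial_z\frac1{s!}\partial_z^s=(s+1)\frac1{(s+1)!}\partial_z^{s+1}$. `fieldDeriv` obeys the same
recursion, so the two agree on all fields once they agree on the seed. -/
theorem ad_transl_normalMul (γ β : Fin l → ℂ) (i : Fin l) (s : ℕ) (A : FockField l) :
    ad (transl γ) (transl β) (normalMul β (i, s) A) =
      ((s : ℤ) + 1) • normalMul β (i, s + 1) A +
        normalMul β (i, s) (ad (transl γ) (transl β) A) := by
  refine field_ext fun v t => ?_
  obtain ⟨N, h1, h2, h3⟩ := ((eventually_normal β i A v t).and
    ((eventually_normal β i A (transl β v) t).and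
    (eventually_normal β i (ad (transl γ) (transl β) A) v t))).exists
  -- One spare term: the shift $k\mapsto k+1$ in `e2` drops the zero $k=0$ term and leaves `range
  -- N`.
  have h1' : ∀ k : ℕ, N + 1 ≤ k → mode β i k v = 0 := fun k hk => h1.2 k (by omega)
  simp only [ad_coeff, LinearMap.add_apply, HahnSeries.coeff_add, LinearMap.smul_apply,
    HahnSeries.coeff_smul]
  rw [normalMul_coeff β (i, s) A v t h1.1 h1', normalMul_coeff β (i, s) A _ t h2.1
    (N := N + 1) fun k hk => h2.2 k (by omega), normalMul_coeff β (i, s) (ad _ _ A) v t h3.1 h1',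
    normalMul_coeff β (i, s + 1) A v t h1.1 h1.2]
  simp only [ad_coeff, map_add, map_sum, map_zsmul, transl_X_mul, mode_transl, smul_add, smul_sub,
    sum_add_distrib, sum_sub_distrib, mul_sub, HahnSeries.coeff_add, HahnSeries.coeff_smul]
  have e1 : ∑ j ∈ range N, ((j + s).choose s : ℤ) • ((((j + s : ℕ) : ℤ) + 1) •
      (MvPolynomial.X (i, j + s + 1) * (A v).coeff (t - j))) =
      ((s : ℤ) + 1) • ∑ j ∈ range N, ((j + (s + 1)).choose (s + 1) : ℤ) •
        (MvPolynomial.X (i, j + (s + 1)) * (A v).coeff (t - j)) := by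
    rw [smul_sum]
    refine sum_congr rfl fun j _ => ?_
    rw [smul_smul, smul_smul, ← add_assoc]
    congr 1
    have := Nat.add_one_mul_choose_eq (j + s) s
    rw [mul_comm, mul_comm ((s : ℤ) + 1)]
    exact_mod_cast this
  have e2 : ∑ k ∈ range (N + 1), Ring.choose (-(k : ℤ) - 1) s • ((k : ℤ) •
      (A (mode β i (k - 1) v)).coeff (t + k + 1 + s)) =
      -(((s : ℤ) + 1) • ∑ k ∈ range N, Ring.choose (-(k : ℤ) - 1) (s + 1) •
        (A (mode β i k v)).coeff (t + k + 1 + ((s + 1 : ℕ) : ℤ))) := by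
    rw [sum_range_succ', Nat.cast_zero, zero_smul, smul_zero, add_zero, smul_sum,
      ← sum_neg_distrib]
    refine sum_congr rfl fun k _ => ?_
    rw [smul_smul, smul_smul, Ring.choose_succ_mul, ← neg_smul]
    push_cast
    rw [add_sub_cancel_right, show t + ((k : ℤ) + 1) + 1 + s = t + k + 1 + (s + 1) by ring,
      show -((k : ℤ) + 1) - 1 = -(k : ℤ) - 1 - 1 by ring]
    congr 1
    ring
  rw [e1, e2]
  abel

theorem fieldDeriv_normalMul (β : Fin l → ℂ) (i : Fin l) (s : ℕ) (A : FockField l) :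
    fieldDeriv (normalMul β (i, s) A) =
      ((s : ℤ) + 1) • normalMul β (i, s + 1) A + normalMul β (i, s) (fieldDeriv A) := by
  refine field_ext fun v t => ?_
  obtain ⟨N, h1, h2, h3⟩ := ((eventually_normal β i A v t).and
    ((eventually_normal β i (fieldDeriv A) v t).and
    (eventually_normal β i A v (t + 1)))).exists
  simp only [fieldDeriv_coeff, LinearMap.add_apply, HahnSeries.coeff_add, LinearMap.smul_apply,
    HahnSeries.coeff_smul]
  rw [normalMul_coeff β (i, s) A v (t + 1) (J := N + 1) (fun j hj => h3.1 j (by omega)) h1.2,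
    normalMul_coeff β (i, s) (fieldDeriv A) v t (J := N + 1) (fun j hj => h2.1 j (by omega)) h1.2,
    normalMul_coeff β (i, s + 1) A v t h1.1 h1.2]
  simp only [fieldDeriv_coeff, smul_add]
  have e1 : (t + 1) • ∑ j ∈ range (N + 1), ((j + s).choose s : ℤ) •
        (MvPolynomial.X (i, j + s) * (A v).coeff (t + 1 - j)) =
      ((s : ℤ) + 1) • ∑ j ∈ range N, ((j + (s + 1)).choose (s + 1) : ℤ) •
        (MvPolynomial.X (i, j + (s + 1)) * (A v).coeff (t - j)) +
      ∑ j ∈ range (N + 1), ((j + s).choose s : ℤ) •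
        (MvPolynomial.X (i, j + s) * ((t - j + 1) • (A v).coeff (t - j + 1))) := by
    rw [← sub_eq_iff_eq_add, smul_sum, ← sum_sub_distrib]
    have e : ∀ j ∈ range (N + 1), (t + 1) • (((j + s).choose s : ℤ) •
        (MvPolynomial.X (i, j + s) * (A v).coeff (t + 1 - j))) - ((j + s).choose s : ℤ) •
        (MvPolynomial.X (i, j + s) * ((t - j + 1) • (A v).coeff (t - j + 1))) =
        ((j : ℤ) * ((j + s).choose s : ℤ)) •
          (MvPolynomial.X (i, j + s) * (A v).coeff (t + 1 - j)) := by
      intro j _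
      rw [mul_smul_comm, smul_smul, smul_smul, show t - (j : ℤ) + 1 = t + 1 - j by ring,
        ← sub_smul]
      congr 1
      ring
    rw [sum_congr rfl e, sum_range_succ', Nat.cast_zero, zero_mul, zero_smul, add_zero, smul_sum]
    refine sum_congr rfl fun j _ => ?_
    rw [smul_smul, show j + 1 + s = j + (s + 1) by ring]
    push_cast
    rw [show t + 1 - ((j : ℤ) + 1) = t - j by ring]
    congr 1
    have := Nat.choose_succ_right_eq (j + (s + 1)) s
    rw [show j + (s + 1) - s = j + 1 by omega] at this
    rw [mul_comm, mul_comm ((s : ℤ) + 1)]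
    exact_mod_cast this.symm
  have e2 : (t + 1) • ∑ k ∈ range N, Ring.choose (-(k : ℤ) - 1) s •
        (A (mode β i k v)).coeff (t + 1 + k + 1 + s) =
      ((s : ℤ) + 1) • ∑ k ∈ range N, Ring.choose (-(k : ℤ) - 1) (s + 1) •
        (A (mode β i k v)).coeff (t + k + 1 + ((s + 1 : ℕ) : ℤ)) +
      ∑ k ∈ range N, Ring.choose (-(k : ℤ) - 1) s •
        ((t + k + 1 + s + 1) • (A (mode β i k v)).coeff (t + k + 1 + s + 1)) := by
    rw [smul_sum, smul_sum, ← sum_add_distrib]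
    refine sum_congr rfl fun k _ => ?_
    rw [smul_smul, smul_smul, smul_smul, Ring.choose_succ_mul, ← Ring.sub_mul_choose]
    push_cast
    rw [show t + 1 + (k : ℤ) + 1 + s = t + k + 1 + s + 1 by ring,
      show t + (k : ℤ) + 1 + (s + 1) = t + k + 1 + s + 1 by ring, ← add_smul]
    congr 1
    ring
  rw [e1, e2]
  abel

theorem ad_transl_fieldOf {γ β : Fin l → ℂ} {B : FockField l}
    (hB : ad (transl γ) (transl β) B = fieldDeriv B) (w : Fock l) :
    ad (transl γ) (transl β) (fieldOf β B w) = fieldDeriv (fieldOf β B w) := by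
  induction w using fock_induction with
  | one => rw [fieldOf_one, hB]
  | add u v hu hv => rw [map_add, map_add, map_add, hu, hv]
  | smul c u hu => rw [map_smul, map_smul, map_smul, hu]
  | X_mul x u hu => rw [fieldOf_X_mul, ad_transl_normalMul, fieldDeriv_normalMul, hu]

/-- The label $L(-1)w$ satisfies the same recursion as $\partial_z$, so the translation axiom
reduces to the single vector $e^\delta$. -/
theorem fieldOf_transl {β δ : Fin l → ℂ} {B : FockField l}
    (hB : fieldOf β B (transl δ 1) = fieldDeriv B) (w : Fock l) :
    fieldOf β B (transl δ w) = fieldDeriv (fieldOf β B w) := by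
  induction w using fock_induction with
  | one => rw [hB, fieldOf_one]
  | add u v hu hv => rw [map_add, map_add, map_add, map_add, hu, hv]
  | smul c u hu => rw [map_smul, map_smul, map_smul, map_smul, hu]
  | X_mul x u hu =>
    rw [fieldOf_X_mul, fieldDeriv_normalMul, transl_X_mul, map_add, map_zsmul, fieldOf_X_mul,
      fieldOf_X_mul, hu, add_comm]

theorem fieldDeriv_idField : fieldDeriv (idField : FockField l) = 0 := by
  refine field_ext fun v t => ?_
  rw [fieldDeriv_coeff, idField_coeff]
  by_cases h : t + 1 = 0 <;> simp [h]

theorem ad_transl_idField (γ : Fin l → ℂ) :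
    ad (transl γ) (transl γ) idField = fieldDeriv idField := by
  rw [fieldDeriv_idField]
  refine field_ext fun v t => ?_
  simp only [ad_coeff, idField_coeff]
  by_cases h : t = 0 <;> simp [h]

theorem modesOf_translation {γ β : Fin l → ℂ} {B : FockField l}
    (hB : ad (transl γ) (transl β) B = fieldDeriv B) (u : Fock l) (m : ℤ) (v : Fock l) :
    transl γ (modesOf (fieldOf β B) u m v) = modesOf (fieldOf β B) u m (transl β v) +
      (-m) • modesOf (fieldOf β B) u (m - 1) v := by
  have h := congrArg (fun A : FockField l => (A v).coeff (-m - 1)) (ad_transl_fieldOf hB u)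
  simp only [ad_coeff, fieldDeriv_coeff] at h
  rw [sub_eq_iff_eq_add'] at h
  simp only [modesOf_apply]
  rw [h, sub_add_cancel, show -(m - 1) - 1 = -m by ring]

theorem modesOf_transl {β δ : Fin l → ℂ} {B : FockField l}
    (hB : fieldOf β B (transl δ 1) = fieldDeriv B) (w : Fock l) (n : ℤ) :
    modesOf (fieldOf β B) (transl δ w) n = (-n) • modesOf (fieldOf β B) w (n - 1) := by
  refine LinearMap.ext fun v => ?_
  rw [LinearMap.smul_apply, modesOf_apply, modesOf_apply, fieldOf_transl hB, fieldDeriv_coeff,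
    sub_add_cancel, show -(n - 1) - 1 = -n by ring]

/-- On $M_0$ all modes $n\ge0$ kill $\mathbf 1$, so only creation parts act and no negative power of
$z$ can appear. -/
theorem fieldOf_creative {B : FockField l} (h0 : (B 1).coeff 0 = 1)
    (hneg : ∀ t : ℤ, t < 0 → (B 1).coeff t = 0) (w : Fock l) :
    (fieldOf 0 B w 1).coeff 0 = w ∧ ∀ t : ℤ, t < 0 → (fieldOf 0 B w 1).coeff t = 0 := by
  induction w using fock_induction with
  | one => rw [fieldOf_one]; exact ⟨h0, hneg⟩
  | add u v hu hv =>
    refine ⟨by simp [hu.1, hv.1], fun t ht => by simp [hu.2 t ht, hv.2 t ht]⟩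
  | smul c u hu => exact ⟨by simp [hu.1], fun t ht => by simp [hu.2 t ht]⟩
  | X_mul x u hu =>
    rw [fieldOf_X_mul]
    refine ⟨?_, fun t ht => ?_⟩
    · rw [normalMul_coeff 0 x _ 1 0 (J := 1) (N := 0) (fun j hj => hu.2 _ (by omega))
        fun n _ => mode_one x.1 (by omega)]
      simp [hu.1]
    · rw [normalMul_coeff 0 x _ 1 t (J := 0) (N := 0) (fun j _ => hu.2 _ (by omega))
        fun n _ => mode_one x.1 (by omega)]
      simp

/-! ### Exponentials of operator-valued power series -/

theorem coeff_pow_eq_zero {R : Type*} [Ring R] {S : PowerSeries R} (hS : PowerSeries.coeff 0 S = 0)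
    {n k : ℕ} (h : n < k) : PowerSeries.coeff n (S ^ k) = 0 := by
  induction k generalizing n with
  | zero => omega
  | succ k ih =>
    rw [pow_succ', PowerSeries.coeff_mul]
    refine sum_eq_zero fun x hx => ?_
    have hx' := HasAntidiagonal.mem_antidiagonal.1 hx
    rcases Nat.eq_zero_or_pos x.1 with h0 | h0
    · rw [h0, hS, zero_mul]
    · rw [ih (by omega), mul_zero]

theorem commute_of_coeff {R : Type*} [Ring R] {f g : PowerSeries R}
    (h : ∀ i j, Commute (PowerSeries.coeff i f) (PowerSeries.coeff j g)) : Commute f g := by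
  refine PowerSeries.ext fun n => ?_
  rw [PowerSeries.coeff_mul, PowerSeries.coeff_mul, ← Nat.sum_antidiagonal_swap]
  exact sum_congr rfl fun x _ => h _ _

theorem coeff_opExp {S : PowerSeries (Module.End ℂ (Fock l))} (hS : PowerSeries.coeff 0 S = 0)
    {n K : ℕ} (h : n < K) :
    PowerSeries.coeff n (opExp S) =
      ∑ k ∈ range K, ((k.factorial : ℂ)⁻¹) • PowerSeries.coeff n (S ^ k) := by
  rw [opExp, PowerSeries.coeff_mk]
  refine sum_range_eq_sum_range (fun k hk => ?_) (fun k hk => ?_) <;>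
  · rw [coeff_pow_eq_zero hS (by omega), smul_zero]

theorem coeff_zero_opExp (S : PowerSeries (Module.End ℂ (Fock l))) :
    PowerSeries.coeff 0 (opExp S) = 1 := by
  simp [opExp]

/-- A graded derivation `d` with `d S = Z` commuting with `S` satisfies `d (exp S) = Z exp S`. -/
theorem derivation_opExp {S Z : PowerSeries (Module.End ℂ (Fock l))}
    (d : ℕ → Module.End ℂ (Fock l) →ₗ[ℂ] Module.End ℂ (Fock l))
    (leibniz : ∀ i j x y, d (i + j) (x * y) = d i x * y + x * d j y)
    (hS : PowerSeries.coeff 0 S = 0) (hZ : PowerSeries.coeff 0 Z = 0) (hc : Commute S Z)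
    (hd : ∀ n, d n (PowerSeries.coeff n S) = PowerSeries.coeff n Z) (n : ℕ) :
    d n (PowerSeries.coeff n (opExp S)) = PowerSeries.coeff n (Z * opExp S) := by
  have hone : ∀ n, d n (PowerSeries.coeff n (1 : PowerSeries (Module.End ℂ (Fock l)))) = 0 := by
    intro n
    rcases Nat.eq_zero_or_pos n with rfl | hn
    · have := leibniz 0 0 1 1
      simpa using this
    · rw [PowerSeries.coeff_one, if_neg (by omega), map_zero]
  -- Because `S` and `Z` commute, all $k+1$ terms of the derivative of $S^{k+1}$ coincide.
  have hpow : ∀ k n, d n (PowerSeries.coeff n (S ^ (k + 1))) =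
      (k + 1) • PowerSeries.coeff n (Z * S ^ k) := by
    intro k
    induction k with
    | zero => intro n; simp [hd]
    | succ k ih =>
      intro n
      rw [pow_succ, PowerSeries.coeff_mul, map_sum]
      have : ∀ x ∈ antidiagonal n, d n (PowerSeries.coeff x.1 (S ^ (k + 1)) *
          PowerSeries.coeff x.2 S) =
          (k + 1) • (PowerSeries.coeff x.1 (Z * S ^ k) * PowerSeries.coeff x.2 S) +
            PowerSeries.coeff x.1 (S ^ (k + 1)) * PowerSeries.coeff x.2 Z := by
        intro x hx
        rw [← HasAntidiagonal.mem_antidiagonal.1 hx, leibniz, ih, hd, smul_mul_assoc]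
      rw [sum_congr rfl this, sum_add_distrib, ← smul_sum, ← PowerSeries.coeff_mul,
        ← PowerSeries.coeff_mul, (hc.pow_left (k + 1)).eq, mul_assoc, ← pow_succ]
      exact (succ_nsmul _ _).symm
  rw [coeff_opExp hS (Nat.lt_succ_self n), map_sum, sum_range_succ', pow_zero, map_smul, hone,
    smul_zero, add_zero, PowerSeries.coeff_mul]
  have hr : ∀ x ∈ antidiagonal n, PowerSeries.coeff x.1 Z * PowerSeries.coeff x.2 (opExp S) =
      ∑ k ∈ range n, ((k.factorial : ℂ)⁻¹) •
        (PowerSeries.coeff x.1 Z * PowerSeries.coeff x.2 (S ^ k)) := by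
    intro x hx
    have hx' := HasAntidiagonal.mem_antidiagonal.1 hx
    rcases Nat.eq_zero_or_pos x.1 with h0 | h0
    · simp [h0, hZ]
    · rw [coeff_opExp hS (show x.2 < n by omega), mul_sum]
      exact sum_congr rfl fun k _ => mul_smul_comm _ _ _
  rw [sum_congr rfl hr, sum_comm]
  refine sum_congr rfl fun k _ => ?_
  rw [map_smul, hpow, ← smul_sum, ← PowerSeries.coeff_mul, ← Nat.cast_smul_eq_nsmul ℂ, smul_smul]
  congr 1
  rw [Nat.factorial_succ]
  have h1 : ((k : ℂ) + 1) ≠ 0 := by exact_mod_cast Nat.succ_ne_zero k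
  have h2 : (k.factorial : ℂ) ≠ 0 := by exact_mod_cast k.factorial_ne_zero
  push_cast
  field_simp

/-- The commutator with `T`. -/
def commutatorHom (T : Module.End ℂ (Fock l)) :
    Module.End ℂ (Fock l) →ₗ[ℂ] Module.End ℂ (Fock l) :=
  LinearMap.mulLeft ℂ T - LinearMap.mulRight ℂ T

theorem commutatorHom_apply (T x : Module.End ℂ (Fock l)) : commutatorHom T x = T * x - x * T := rfl

theorem commutator_smul (T x : Module.End ℂ (Fock l)) (c : ℂ) :
    T * (c • x) - (c • x) * T = c • (T * x - x * T) :=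
  map_smul (commutatorHom T) c x

theorem commutator_opExp {S Z : PowerSeries (Module.End ℂ (Fock l))} (T : Module.End ℂ (Fock l))
    (hS : PowerSeries.coeff 0 S = 0) (hZ : PowerSeries.coeff 0 Z = 0) (hc : Commute S Z)
    (hd : ∀ n, T * PowerSeries.coeff n S - PowerSeries.coeff n S * T = PowerSeries.coeff n Z)
    (n : ℕ) :
    T * PowerSeries.coeff n (opExp S) - PowerSeries.coeff n (opExp S) * T =
      PowerSeries.coeff n (Z * opExp S) :=
  derivation_opExp (fun _ => commutatorHom T)
    (fun _ _ x y => by simp only [commutatorHom_apply, sub_mul, mul_sub, mul_assoc]; abel) hS hZ hc hd n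

theorem commute_opExp {S : PowerSeries (Module.End ℂ (Fock l))} {T : Module.End ℂ (Fock l)}
    (hS : PowerSeries.coeff 0 S = 0) (hd : ∀ n, Commute T (PowerSeries.coeff n S)) (n : ℕ) :
    Commute T (PowerSeries.coeff n (opExp S)) := by
  have := commutator_opExp (Z := 0) T hS (map_zero _) (Commute.zero_right S)
    (fun n => by rw [(hd n).eq, sub_self, map_zero]) n
  rw [zero_mul, map_zero, sub_eq_zero] at this
  exact this

/-- The graded derivation is $z\,d/dz$; the result is a recursion for the coefficients of the
exponential. -/
theorem euler_opExp {S : PowerSeries (Module.End ℂ (Fock l))}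
    (hS : PowerSeries.coeff 0 S = 0)
    (hc : ∀ i j, Commute (PowerSeries.coeff i S) (PowerSeries.coeff j S)) (n : ℕ) :
    n • PowerSeries.coeff n (opExp S) =
      PowerSeries.coeff n ((PowerSeries.mk fun m => m • PowerSeries.coeff m S) * opExp S) := by
  refine derivation_opExp (fun n => n • LinearMap.id)
    (fun i j x y => ?_) hS (by simp) (commute_of_coeff fun i j => ?_) (fun n => ?_) n
  · change (i + j) • (x * y) = i • x * y + x * (j • y)
    rw [add_smul, smul_mul_assoc, mul_smul_comm]
  · rw [PowerSeries.coeff_mk]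
    exact (hc i j).smul_right j
  · rw [PowerSeries.coeff_mk, LinearMap.smul_apply, LinearMap.id_apply]

/-! ### The operators `Y_±` -/

theorem alphaMode_apply (β α : Fin l → ℂ) (n : ℤ) (v : Fock l) :
    alphaMode β α n v = ∑ i, α i • mode β i n v := by
  simp [alphaMode]

theorem mode_alphaMode (α : Fin l → ℂ) (i : Fin l) (n m : ℤ) :
    mode 0 i n * alphaMode 0 α m - alphaMode 0 α m * mode 0 i n =
      (if n = -m then (n : ℂ) * α i else 0) • (1 : Module.End ℂ (Fock l)) := by
  refine LinearMap.ext fun v => ?_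
  rw [LinearMap.sub_apply, Module.End.mul_apply, Module.End.mul_apply, alphaMode_apply,
    alphaMode_apply, map_sum, ← sum_sub_distrib]
  simp only [map_smul, mode_commutator 0 i _ n m, smul_add, add_sub_cancel_left]
  rw [sum_eq_single i]
  · by_cases h : n = -m
    · rw [if_pos ⟨rfl, h⟩, if_pos h, ← Int.cast_smul_eq_zsmul ℂ, smul_smul, mul_comm]
      rfl
    · rw [if_neg (by tauto), if_neg h]
      simp
  · intro j _ hj
    rw [if_neg (fun h => hj h.1.symm), zero_smul, smul_zero]
  · simp

theorem alphaMode_commute (α : Fin l → ℂ) {n m : ℤ} (h : 0 < n * m ∨ n = 0 ∨ m = 0) :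
    Commute (alphaMode 0 α n) (alphaMode 0 α m) := by
  rw [alphaMode]
  refine Commute.sum_left _ _ _ fun i _ => Commute.smul_left ?_ _
  have h1 := mode_alphaMode α i n m
  have : (if n = -m then (n : ℂ) * α i else 0) = 0 := by
    split_ifs with h'
    · subst h'
      rcases h with h | h | h
      · nlinarith [mul_self_nonneg m]
      · simp [h]
      · simp [h]
    · rfl
  rw [this, zero_smul, sub_eq_zero] at h1
  exact h1

/-- The coefficient of `z^m` in `Y_-(α,z)`. -/
abbrev minusCoeff (α : Fin l → ℂ) (m : ℕ) : Module.End ℂ (Fock l) :=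
  PowerSeries.coeff m (expMinus 0 α)

/-- The coefficient of `z^{-p}` in `Y_+(α,z)`. -/
abbrev plusCoeff (α : Fin l → ℂ) (p : ℕ) : Module.End ℂ (Fock l) :=
  PowerSeries.coeff p (expPlus 0 α)

theorem minusCoeff_zero (α : Fin l → ℂ) : minusCoeff α 0 = 1 := coeff_zero_opExp _

theorem plusCoeff_zero (α : Fin l → ℂ) : plusCoeff α 0 = 1 := coeff_zero_opExp _

theorem commute_minusCoeff {α : Fin l → ℂ} {T : Module.End ℂ (Fock l)}
    (h : ∀ n : ℕ, 0 < n → Commute T (alphaMode 0 α (-(n : ℤ)))) (m : ℕ) :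
    Commute T (minusCoeff α m) := by
  refine commute_opExp (by simp) (fun n => ?_) m
  rw [PowerSeries.coeff_mk]
  split_ifs with h0
  · exact Commute.zero_right T
  · exact (h n (by omega)).smul_right _

theorem commute_plusCoeff {α : Fin l → ℂ} {T : Module.End ℂ (Fock l)}
    (h : ∀ n : ℕ, 0 < n → Commute T (alphaMode 0 α n)) (m : ℕ) :
    Commute T (plusCoeff α m) := by
  refine commute_opExp (by simp) (fun n => ?_) m
  rw [PowerSeries.coeff_mk]
  split_ifs with h0
  · exact Commute.zero_right T
  · exact (h n (by omega)).smul_right _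

theorem mode_commute_alphaMode (α : Fin l → ℂ) (i : Fin l) {n m : ℤ} (h : n ≠ -m ∨ n = 0) :
    Commute (mode 0 i n) (alphaMode 0 α m) := by
  have h1 := mode_alphaMode α i n m
  have : (if n = -m then (n : ℂ) * α i else 0) = 0 := by
    rcases h with h | h
    · rw [if_neg h]
    · simp [h]
  rw [this, zero_smul, sub_eq_zero] at h1
  exact h1

theorem minusCoeff_mode_nonpos (α : Fin l → ℂ) (i : Fin l) {n : ℤ} (hn : n ≤ 0) (m : ℕ)
    (v : Fock l) : minusCoeff α m (mode 0 i n v) = mode 0 i n (minusCoeff α m v) :=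
  (LinearMap.congr_fun (commute_minusCoeff (fun k _ => mode_commute_alphaMode α i
    (by omega)) m).eq v).symm

theorem plusCoeff_mode_nonneg (α : Fin l → ℂ) (i : Fin l) {n : ℤ} (hn : 0 ≤ n) (p : ℕ)
    (v : Fock l) : plusCoeff α p (mode 0 i n v) = mode 0 i n (plusCoeff α p v) :=
  (LinearMap.congr_fun (commute_plusCoeff (fun k _ => mode_commute_alphaMode α i
    (by omega)) p).eq v).symm

theorem commute_smul_X_pow {R : Type*} [Ring R] [Algebra ℂ R] (f : PowerSeries R) (c : ℂ) (n : ℕ) :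
    Commute f (c • PowerSeries.X ^ n) :=
  (PowerSeries.commute_X_pow f n).smul_right c

/-- The commutator of $a^i(k+1)$ with the exponent is the scalar $\alpha^iz^{k+1}$, hence
$[a^i(k+1),Y_-]=\alpha^iz^{k+1}Y_-$. -/
theorem mode_minusCoeff_pos (α : Fin l → ℂ) (i : Fin l) (k m : ℕ) (v : Fock l) :
    mode 0 i ((k : ℤ) + 1) (minusCoeff α m v) = minusCoeff α m (mode 0 i ((k : ℤ) + 1) v) +
      if k + 1 ≤ m then α i • minusCoeff α (m - (k + 1)) v else 0 := by
  have h := commutator_opExp (Z := α i • PowerSeries.X ^ (k + 1)) (mode 0 i ((k : ℤ) + 1))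
    (S := PowerSeries.mk fun n => if n = 0 then 0 else ((n : ℂ)⁻¹) • alphaMode 0 α (-(n : ℤ)))
    (by simp) (by simp) (commute_smul_X_pow _ _ _) (fun n => ?_) m
  · rw [smul_mul_assoc, PowerSeries.coeff_smul, PowerSeries.coeff_X_pow_mul'] at h
    have h' := LinearMap.congr_fun h v
    rw [LinearMap.sub_apply, Module.End.mul_apply, Module.End.mul_apply, sub_eq_iff_eq_add'] at h'
    refine h'.trans ?_
    congr 1
    split_ifs
    · rfl
    · simp
  · rw [PowerSeries.coeff_mk, PowerSeries.coeff_smul, PowerSeries.coeff_X_pow]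
    rcases Nat.eq_zero_or_pos n with rfl | hn
    · simp
    · rw [if_neg (by omega), commutator_smul, mode_alphaMode, smul_smul]
      by_cases hk : n = k + 1
      · subst hk
        rw [if_pos (by push_cast; ring), if_pos rfl]
        have h1 : ((k : ℂ) + 1) ≠ 0 := by exact_mod_cast Nat.succ_ne_zero k
        push_cast
        rw [inv_mul_cancel_left₀ h1]
      · rw [if_neg (by omega), if_neg hk]
        simp

/-- The mirror relation $[a^i(-k-1),Y_+]=\alpha^iz^{-k-1}Y_+$. -/
theorem plusCoeff_X_mul (α : Fin l → ℂ) (i : Fin l) (k p : ℕ) (v : Fock l) :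
    MvPolynomial.X (i, k) * plusCoeff α p v = plusCoeff α p (MvPolynomial.X (i, k) * v) +
      if k + 1 ≤ p then α i • plusCoeff α (p - (k + 1)) v else 0 := by
  have h := commutator_opExp (Z := α i • PowerSeries.X ^ (k + 1)) (mode 0 i (-(k : ℤ) - 1))
    (S := PowerSeries.mk fun n => if n = 0 then 0 else (-(n : ℂ)⁻¹) • alphaMode 0 α (n : ℤ))
    (by simp) (by simp) (commute_smul_X_pow _ _ _) (fun n => ?_) p
  · rw [smul_mul_assoc, PowerSeries.coeff_smul, PowerSeries.coeff_X_pow_mul'] at h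
    have h' := LinearMap.congr_fun h v
    rw [LinearMap.sub_apply, Module.End.mul_apply, Module.End.mul_apply, sub_eq_iff_eq_add',
      mode_neg_succ, mode_neg_succ] at h'
    refine h'.trans ?_
    congr 1
    split_ifs
    · rfl
    · simp
  · rw [PowerSeries.coeff_mk, PowerSeries.coeff_smul, PowerSeries.coeff_X_pow]
    rcases Nat.eq_zero_or_pos n with rfl | hn
    · simp
    · rw [if_neg (by omega), commutator_smul, mode_alphaMode, smul_smul]
      by_cases hk : n = k + 1
      · subst hk
        rw [if_pos (by push_cast; ring), if_pos rfl]
        have h1 : ((k : ℂ) + 1) ≠ 0 := by exact_mod_cast Nat.succ_ne_zero k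
        push_cast
        congr 1
        field_simp
        ring
      · rw [if_neg (by omega), if_neg hk]
        simp

/-- $Y_-$ commutes with all creation modes, which are the multiplications generating the polynomial
ring. -/
theorem minusCoeff_apply (α : Fin l → ℂ) (m : ℕ) (v : Fock l) :
    minusCoeff α m v = minusCoeff α m 1 * v := by
  induction v using fock_induction with
  | one => rw [mul_one]
  | add u v hu hv => rw [map_add, hu, hv, mul_add]
  | smul c u hu => rw [map_smul, hu, mul_smul_comm]
  | X_mul x u hu =>
    rw [← mode_neg_succ 0 x.1 x.2, minusCoeff_mode_nonpos α x.1 (by omega), hu, mode_neg_succ,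
      mode_neg_succ, mul_left_comm]

/-- By the Euler recursion, $p$ times this vector is a sum of terms in which some $\alpha(n)$,
$n>0$, can be moved onto the vacuum. -/
theorem plusCoeff_one (α : Fin l → ℂ) {p : ℕ} (hp : 0 < p) : plusCoeff α p 1 = 0 := by
  have hcomm : ∀ i j : ℕ, Commute (if i = 0 then 0 else (-(i : ℂ)⁻¹) • alphaMode 0 α (i : ℤ))
      (if j = 0 then 0 else (-(j : ℂ)⁻¹) • alphaMode 0 α (j : ℤ)) := by
    intro i j
    split_ifs with h1 h2 h2
    · exact Commute.zero_left _
    · exact Commute.zero_left _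
    · exact Commute.zero_right _
    · refine ((alphaMode_commute α ?_).smul_left _).smul_right _
      left
      positivity
  have h := euler_opExp (S := PowerSeries.mk fun n =>
    if n = 0 then 0 else (-(n : ℂ)⁻¹) • alphaMode 0 α (n : ℤ)) (by simp)
    (fun i j => by rw [PowerSeries.coeff_mk, PowerSeries.coeff_mk]; exact hcomm i j) p
  have h1 := LinearMap.congr_fun h 1
  rw [PowerSeries.coeff_mul, LinearMap.sum_apply, sum_eq_zero] at h1
  · rw [LinearMap.smul_apply, ← Nat.cast_smul_eq_nsmul ℂ] at h1
    exact (smul_eq_zero.1 h1).resolve_left (by exact_mod_cast hp.ne')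
  · intro x _
    rw [PowerSeries.coeff_mk, PowerSeries.coeff_mk, smul_mul_assoc, LinearMap.smul_apply]
    rcases Nat.eq_zero_or_pos x.1 with h0 | h0
    · simp [h0]
    · have hc := commute_plusCoeff (T := alphaMode 0 α x.1)
        (fun n hn => alphaMode_commute α (Or.inl (by positivity))) x.2
      have hv : alphaMode 0 α x.1 (1 : Fock l) = 0 := by
        rw [alphaMode_apply]
        exact sum_eq_zero fun i _ => by rw [mode_one i (by omega), smul_zero]
      have := LinearMap.congr_fun hc.eq 1
      rw [Module.End.mul_apply, Module.End.mul_apply, hv, map_zero] at this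
      rw [if_neg (by omega), smul_mul_assoc, LinearMap.smul_apply, Module.End.mul_apply]
      refine (congrArg _ (congrArg _ this)).trans ?_
      simp

/-- $Y_+v$ is a polynomial in $z^{-1}$; this makes the dressed field lower truncated and all its
sums finite. -/
theorem eventually_plusCoeff_eq_zero (α : Fin l → ℂ) (v : Fock l) :
    ∀ᶠ p : ℕ in atTop, plusCoeff α p v = 0 := by
  induction v using fock_induction with
  | one =>
    filter_upwards [eventually_gt_atTop 0] with p hp
    exact plusCoeff_one α hp
  | add u v hu hv =>
    filter_upwards [hu, hv] with p h1 h2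
    rw [map_add, h1, h2, add_zero]
  | smul c u hu =>
    filter_upwards [hu] with p h1
    rw [map_smul, h1, smul_zero]
  | X_mul x u hu =>
    obtain ⟨N, hN⟩ := hu.exists_forall_of_atTop
    filter_upwards [eventually_ge_atTop (N + (x.2 + 1))] with p hp
    have h := plusCoeff_X_mul α x.1 x.2 p u
    rw [hN p (by omega), hN (p - (x.2 + 1)) (by omega), smul_zero, ite_self, add_zero,
      mul_zero] at h
    exact h.symm

theorem succ_smul_minusCoeff (α : Fin l → ℂ) (n : ℕ) :
    (n + 1) • minusCoeff α (n + 1) 1 =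
      ∑ x ∈ antidiagonal n, ∑ i, α i • (MvPolynomial.X (i, x.1) * minusCoeff α x.2 1) := by
  have h := euler_opExp (S := PowerSeries.mk fun n =>
    if n = 0 then 0 else ((n : ℂ)⁻¹) • alphaMode 0 α (-(n : ℤ))) (by simp)
    (fun i j => ?_) (n + 1)
  · have h1 := LinearMap.congr_fun h 1
    rw [PowerSeries.coeff_mul, LinearMap.sum_apply, Nat.sum_antidiagonal_succ] at h1
    refine h1.trans ?_
    simp only [PowerSeries.coeff_mk, zero_smul, zero_mul, LinearMap.zero_apply, zero_add]
    refine sum_congr rfl fun x _ => ?_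
    rw [if_neg (Nat.succ_ne_zero _), ← Nat.cast_smul_eq_nsmul ℂ, smul_smul, mul_inv_cancel₀
      (by exact_mod_cast Nat.succ_ne_zero x.1), one_smul, Module.End.mul_apply, alphaMode_apply]
    refine sum_congr rfl fun i _ => ?_
    rw [show -((x.1 + 1 : ℕ) : ℤ) = -(x.1 : ℤ) - 1 by push_cast; ring, mode_neg_succ]
    rfl
  · rw [PowerSeries.coeff_mk, PowerSeries.coeff_mk]
    split_ifs with h1 h2 h2
    · exact Commute.zero_left _
    · exact Commute.zero_left _
    · exact Commute.zero_right _
    · refine ((alphaMode_commute α ?_).smul_left _).smul_right _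
      left
      rw [neg_mul_neg]
      positivity

/-- $L_{M_\alpha}(-1)Y_-\mathbf 1=\partial_zY_-\mathbf 1$. From
$[L_{M_0}(-1),\alpha(-m)]=m\,\alpha(-m-1)$ come all terms of `succ_smul_minusCoeff` except the one
with $\alpha(-1)$. -/
theorem transl_minusCoeff (α : Fin l → ℂ) (n : ℕ) :
    transl α (minusCoeff α n 1) = (n + 1) • minusCoeff α (n + 1) 1 := by
  have hT : ∀ m : ℕ, transl 0 * alphaMode 0 α (-(m : ℤ)) - alphaMode 0 α (-(m : ℤ)) * transl 0 =
      (m : ℂ) • alphaMode 0 α (-(m : ℤ) - 1) := by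
    intro m
    refine LinearMap.ext fun v => ?_
    rw [LinearMap.sub_apply, Module.End.mul_apply, Module.End.mul_apply, LinearMap.smul_apply,
      alphaMode_apply, alphaMode_apply, alphaMode_apply, map_sum, ← sum_sub_distrib, smul_sum]
    refine sum_congr rfl fun i _ => ?_
    rw [map_smul, mode_transl, ← smul_sub, sub_add_cancel_left, smul_comm (m : ℂ), neg_smul,
      neg_neg, ← Int.cast_smul_eq_zsmul ℂ, Int.cast_natCast]
  have h := commutator_opExp (S := PowerSeries.mk fun n =>
      if n = 0 then 0 else ((n : ℂ)⁻¹) • alphaMode 0 α (-(n : ℤ)))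
    (Z := PowerSeries.mk fun n => if n = 0 then 0 else alphaMode 0 α (-(n : ℤ) - 1))
    (transl 0) (by simp) (by simp) (commute_of_coeff fun i j => ?_) (fun m => ?_) n
  · have h1 := LinearMap.congr_fun h 1
    rw [LinearMap.sub_apply, Module.End.mul_apply, Module.End.mul_apply, transl_zero_one, map_zero,
      sub_zero, PowerSeries.coeff_mul, LinearMap.sum_apply] at h1
    rw [transl_eq_add, succ_smul_minusCoeff]
    refine (congrArg (· + _) h1).trans ?_
    -- The missing $\alpha(-1)$ term is supplied by the zero modes in $L_{M_\alpha}(-1)$.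
    have h0 : ∑ i, α i • (MvPolynomial.X (i, 0) * minusCoeff α n 1) =
        ∑ x ∈ antidiagonal n, if x.1 = 0 then
          ∑ i, α i • (MvPolynomial.X (i, x.1) * minusCoeff α x.2 1) else 0 := by
      rw [sum_eq_single_of_mem (0, n) (by simp), if_pos rfl]
      intro x hx hx0
      rw [if_neg]
      intro h
      have := HasAntidiagonal.mem_antidiagonal.1 hx
      exact hx0 (Prod.ext h (by simp; omega))
    rw [h0, ← sum_add_distrib]
    refine sum_congr rfl fun x _ => ?_
    rw [PowerSeries.coeff_mk]
    split_ifs with hx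
    · rw [zero_mul, LinearMap.zero_apply, zero_add]
    · rw [add_zero, Module.End.mul_apply, alphaMode_apply]
      simp only [mode_neg_succ]
      rfl
  · rw [PowerSeries.coeff_mk, PowerSeries.coeff_mk]
    split_ifs with h1 h2 h2
    · exact Commute.zero_left _
    · exact Commute.zero_left _
    · exact Commute.zero_right _
    · refine (alphaMode_commute α ?_).smul_left _
      left
      nlinarith [Nat.pos_of_ne_zero h1, Nat.pos_of_ne_zero h2]
  · rw [PowerSeries.coeff_mk, PowerSeries.coeff_mk]
    split_ifs with h0
    · simp
    · rw [commutator_smul, hT, smul_smul, inv_mul_cancel₀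
        (by exact_mod_cast h0), one_smul]

/-! ### Dressed fields -/

/-- `Y_-(α,z) 𝟏`, by which `Y_-(α,z)` multiplies. -/
def minusSeries (α : Fin l → ℂ) : LaurentSeries (Fock l) :=
  HahnSeries.ofPowerSeries ℤ (Fock l) (PowerSeries.mk fun m => minusCoeff α m 1)

theorem minusSeries_coeff_natCast (α : Fin l → ℂ) (m : ℕ) :
    (minusSeries α).coeff m = minusCoeff α m 1 := by
  rw [minusSeries, HahnSeries.ofPowerSeries_apply_coeff, PowerSeries.coeff_mk]

theorem minusSeries_coeff_of_neg (α : Fin l → ℂ) {m : ℤ} (hm : m < 0) :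
    (minusSeries α).coeff m = 0 := by
  rw [minusSeries, HahnSeries.ofPowerSeries_apply]
  refine HahnSeries.embDomain_of_notMem_range ?_
  rintro ⟨k, hk⟩
  have : (k : ℤ) = m := hk
  omega

theorem laurent_mul_smul (c : ℂ) (a b : LaurentSeries (Fock l)) : a * c • b = c • (a * b) := by
  have hc : ∀ b : LaurentSeries (Fock l), c • b = HahnSeries.C (MvPolynomial.C c) * b := by
    intro b
    ext1
    funext n
    rw [HahnSeries.C_mul_eq_smul, HahnSeries.coeff_smul, HahnSeries.coeff_smul,
      MvPolynomial.smul_eq_C_mul, smul_eq_mul]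
  rw [hc, hc, mul_left_comm]

theorem dress_finite (α : Fin l → ℂ) (A : FockField l) (v : Fock l) :
    (Function.support fun p : ℕ =>
      HahnSeries.single (-(p : ℤ)) (1 : Fock l) * A (plusCoeff α p v)).Finite := by
  obtain ⟨N, hN⟩ := (eventually_plusCoeff_eq_zero α v).exists_forall_of_atTop
  refine (range N).finite_toSet.subset fun p hp => ?_
  by_contra h
  simp only [coe_range, Set.mem_Iio, not_lt] at h
  exact hp (by simp [hN p h])

/-- The field `Y_-(α,z) A(z) Y_+(α,z)`. -/
def dress (α : Fin l → ℂ) (A : FockField l) : FockField l where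
  toFun v := minusSeries α *
    ∑ᶠ p : ℕ, HahnSeries.single (-(p : ℤ)) (1 : Fock l) * A (plusCoeff α p v)
  map_add' v w := by
    rw [← mul_add, ← finsum_add_distrib (dress_finite α A v) (dress_finite α A w)]
    simp only [map_add, mul_add]
  map_smul' c v := by
    rw [RingHom.id_apply, ← laurent_mul_smul, smul_finsum' c (dress_finite α A v)]
    simp only [map_smul, laurent_mul_smul]

theorem dress_eq_sum (α : Fin l → ℂ) (A : FockField l) (v : Fock l) {N : ℕ}
    (hN : ∀ p, N ≤ p → plusCoeff α p v = 0) :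
    dress α A v = minusSeries α * ∑ p ∈ range N,
      HahnSeries.single (-(p : ℤ)) (1 : Fock l) * A (plusCoeff α p v) := by
  change minusSeries α * ∑ᶠ p : ℕ, _ = _
  rw [finsum_eq_sum_range fun p hp => by simp [hN p hp]]

/-- $Y_-$ and the creation part are both multiplications, and $Y_+$ commutes with the modes $n\ge0$,
so dressing respects normal order on either side. -/
theorem dress_normalMul (α : Fin l → ℂ) (x : Fin l × ℕ) (A : FockField l) :
    dress α (normalMul 0 x A) = normalMul 0 x (dress α A) := by
  refine LinearMap.ext fun v => ?_
  obtain ⟨P, hP⟩ := (eventually_plusCoeff_eq_zero α v).exists_forall_of_atTop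
  obtain ⟨N, hN⟩ := (eventually_mode_eq_zero 0 x.1 v).exists_forall_of_atTop
  have hc : ∀ p n : ℕ, mode 0 x.1 n (plusCoeff α p v) = plusCoeff α p (mode 0 x.1 n v) :=
    fun p n => (plusCoeff_mode_nonneg α x.1 (by omega) p v).symm
  rw [dress_eq_sum α _ v hP, normalMul_eq_sum 0 x _ v N hN, dress_eq_sum α A v hP,
    sum_congr rfl fun p _ => by rw [normalMul_eq_sum 0 x A (plusCoeff α p v) N
      (fun n hn => by rw [hc, hN n hn, map_zero]), mul_add, mul_sum],
    sum_add_distrib, mul_add, sum_comm]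
  refine congrArg₂ (· + ·) ?_ ?_
  · rw [mul_left_comm, mul_sum (range P) _ (creationPart x)]
    refine congrArg (minusSeries α * ·) ?_
    exact sum_congr rfl fun p _ => mul_left_comm _ _ _
  · rw [mul_sum]
    refine sum_congr rfl fun n _ => ?_
    rw [dress_eq_sum α A (mode 0 x.1 n v) (N := P) fun p hp => by rw [← hc, hP p hp, map_zero],
      mul_left_comm, mul_sum (range P) _ (annihilationCoeff x.2 n)]
    refine congrArg (minusSeries α * ·) ?_
    refine sum_congr rfl fun p _ => ?_
    rw [mul_left_comm, hc]

/-- The field `Y_-(α,z) Y_+(α,z)`. -/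
def expField (α : Fin l → ℂ) : FockField l := dress α idField

theorem dress_fieldOf (α : Fin l → ℂ) (u : Fock l) :
    dress α (fieldOf 0 idField u) = fieldOf 0 (expField α) u := by
  have hadd : ∀ A B : FockField l, dress α (A + B) = dress α A + dress α B := by
    intro A B
    refine LinearMap.ext fun v => ?_
    obtain ⟨P, hP⟩ := (eventually_plusCoeff_eq_zero α v).exists_forall_of_atTop
    rw [LinearMap.add_apply, dress_eq_sum α _ v hP, dress_eq_sum α _ v hP, dress_eq_sum α _ v hP,
      ← mul_add, ← sum_add_distrib]
    simp only [LinearMap.add_apply, mul_add]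
  have hsmul : ∀ (c : ℂ) (A : FockField l), dress α (c • A) = c • dress α A := by
    intro c A
    refine LinearMap.ext fun v => ?_
    obtain ⟨P, hP⟩ := (eventually_plusCoeff_eq_zero α v).exists_forall_of_atTop
    rw [LinearMap.smul_apply, dress_eq_sum α _ v hP, dress_eq_sum α _ v hP]
    simp only [LinearMap.smul_apply, laurent_mul_smul, ← smul_sum]
  induction u using fock_induction with
  | one => rw [fieldOf_one, fieldOf_one, expField]
  | add u v hu hv => rw [map_add, map_add, hadd, hu, hv]
  | smul c u hu => rw [map_smul, map_smul, hsmul, hu]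
  | X_mul x u hu => rw [fieldOf_X_mul, fieldOf_X_mul, dress_normalMul, hu]

/-! ### Covariance and differential equations of $Y_-Y_+$ -/

theorem expField_coeff (α : Fin l → ℂ) (v : Fock l) (t : ℤ) {N : ℕ}
    (hN : ∀ p, N ≤ p → plusCoeff α p v = 0) :
    (expField α v).coeff t =
      ∑ p ∈ range N, (minusSeries α).coeff (t + p) * plusCoeff α p v := by
  rw [expField, dress_eq_sum α _ v hN, mul_sum, HahnSeries.coeff_sum]
  refine sum_congr rfl fun p _ => ?_
  change (minusSeries α * (HahnSeries.single (-(p : ℤ)) 1 *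
    HahnSeries.single 0 (plusCoeff α p v))).coeff t = _
  rw [HahnSeries.single_mul_single, HahnSeries.coeff_mul_single, one_mul, add_zero, sub_neg_eq_add]

theorem expField_one_coeff (α : Fin l → ℂ) (t : ℤ) :
    (expField α 1).coeff t = (minusSeries α).coeff t := by
  rw [expField_coeff α 1 t (N := 1) fun p hp => plusCoeff_one α (by omega)]
  simp [plusCoeff_zero]

theorem mode_minusSeries_coeff (α : Fin l → ℂ) (i : Fin l) (k : ℕ) (m : ℤ) :
    mode 0 i ((k : ℤ) + 1) ((minusSeries α).coeff m) =
      α i • (minusSeries α).coeff (m - (k + 1)) := by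
  rcases lt_or_ge m 0 with hm | hm
  · rw [minusSeries_coeff_of_neg α hm, minusSeries_coeff_of_neg α (by omega), map_zero, smul_zero]
  · lift m to ℕ using hm
    rw [minusSeries_coeff_natCast, mode_minusCoeff_pos, mode_one i (by omega), map_zero, zero_add]
    split_ifs with h
    · rw [← minusSeries_coeff_natCast]
      push_cast [h]
      rfl
    · rw [minusSeries_coeff_of_neg α (by omega), smul_zero]

theorem mode_pos_mul (γ : Fin l → ℂ) (i : Fin l) (k : ℕ) (u v : Fock l) :
    mode γ i ((k : ℤ) + 1) (u * v) =
      mode γ i ((k : ℤ) + 1) u * v + u * mode γ i ((k : ℤ) + 1) v := by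
  simp only [mode_succ]
  rw [Derivation.leibniz, smul_eq_mul, smul_eq_mul, smul_add, add_comm, mul_smul_comm,
    smul_mul_assoc, mul_comm v]

/-- Negative `n` is accounted for by $Y_+$ and positive `n` by $Y_-$; $n=0$ is the difference of the
zero modes on $M_\alpha$ and $M_0$. -/
theorem ad_mode_expField (α : Fin l → ℂ) (i : Fin l) (n : ℤ) :
    ad (mode α i n) (mode 0 i n) (expField α) = α i • shift n (expField α) := by
  refine field_ext fun v t => ?_
  rw [ad_coeff, LinearMap.smul_apply, HahnSeries.coeff_smul, shift_coeff]
  obtain ⟨N, hN⟩ := ((eventually_plusCoeff_eq_zero α v).and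
    (eventually_plusCoeff_eq_zero α (mode 0 i n v))).exists_forall_of_atTop
  rcases lt_trichotomy n 0 with hn | rfl | hn
  · obtain ⟨k, rfl⟩ : ∃ k : ℕ, n = -(k : ℤ) - 1 := ⟨(-1 - n).toNat, by omega⟩
    rw [expField_coeff α v t (N := k + 1 + N) fun p hp => (hN p (by omega)).1,
      expField_coeff α _ t (N := k + 1 + N) fun p hp => (hN p (by omega)).2,
      expField_coeff α v _ fun p hp => (hN p hp).1, mode_neg_succ, mode_neg_succ, mul_sum,
      ← sum_sub_distrib]
    have h : ∀ p ∈ range (k + 1 + N), MvPolynomial.X (i, k) * ((minusSeries α).coeff (t + p) *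
        plusCoeff α p v) - (minusSeries α).coeff (t + p) *
          plusCoeff α p (MvPolynomial.X (i, k) * v) =
        (minusSeries α).coeff (t + p) *
          if k + 1 ≤ p then α i • plusCoeff α (p - (k + 1)) v else 0 := by
      intro p _
      rw [mul_left_comm, plusCoeff_X_mul, mul_add, add_sub_cancel_left]
    rw [sum_congr rfl h, sum_range_add, sum_eq_zero, zero_add, smul_sum]
    · refine sum_congr rfl fun p _ => ?_
      rw [if_pos (by omega), Nat.add_sub_cancel_left, mul_smul_comm]
      push_cast
      rw [show t + ((k : ℤ) + 1 + p) = t - (-(k : ℤ) - 1) + p by ring]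
    · intro p hp
      rw [if_neg (by have := mem_range.1 hp; omega), mul_zero]
  · rw [mode_zero, mode_zero, sub_zero]
    simp
  · obtain ⟨k, rfl⟩ : ∃ k : ℕ, n = (k : ℤ) + 1 := ⟨(n - 1).toNat, by omega⟩
    rw [expField_coeff α v t fun p hp => (hN p hp).1,
      expField_coeff α _ t fun p hp => (hN p hp).2,
      expField_coeff α v _ fun p hp => (hN p hp).1, map_sum, ← sum_sub_distrib, smul_sum]
    refine sum_congr rfl fun p _ => ?_
    rw [mode_eq_add, if_neg (by omega), zero_smul, add_zero, mode_pos_mul,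
      mode_minusSeries_coeff, plusCoeff_mode_nonneg α i (by omega), add_sub_cancel_right,
      smul_mul_assoc, show t + (p : ℤ) - (k + 1) = t - (k + 1) + p by ring]

/-- Covariance under creation modes carries vanishing from $\mathbf 1$ to all of $M^l$. Identities
between such fields thus need checking on the vacuum only. -/
theorem field_eq_zero {α : Fin l → ℂ} {G : FockField l} (h1 : G 1 = 0)
    (h : ∀ i n, ad (mode α i n) (mode 0 i n) G = α i • shift n G) : G = 0 := by
  refine LinearMap.ext fun v => ?_
  induction v using fock_induction with
  | one => exact h1
  | add u v hu hv => rw [map_add, hu, hv]; simp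
  | smul c u hu => rw [map_smul, hu]; simp
  | X_mul x u hu =>
    refine HahnSeries.ext (funext fun t => ?_)
    have := congrArg (fun A : FockField l => (A u).coeff t) (h x.1 (-(x.2 : ℤ) - 1))
    simp only [ad_coeff, LinearMap.smul_apply, HahnSeries.coeff_smul, shift_coeff, mode_neg_succ,
      hu] at this
    simpa using this

theorem fieldDeriv_shift (n : ℤ) (A : FockField l) :
    fieldDeriv (shift n A) = n • shift (n - 1) A + shift n (fieldDeriv A) := by
  refine field_ext fun v t => ?_
  simp only [fieldDeriv_coeff, shift_coeff, LinearMap.add_apply, HahnSeries.coeff_add,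
    LinearMap.smul_apply, HahnSeries.coeff_smul]
  rw [show t - (n - 1) = t - n + 1 by ring, show t + 1 - n = t - n + 1 by ring, ← add_smul]
  congr 1
  ring

theorem ad_fieldDeriv (T T' : Module.End ℂ (Fock l)) (A : FockField l) :
    ad T T' (fieldDeriv A) = fieldDeriv (ad T T' A) := by
  refine field_ext fun v t => ?_
  simp only [fieldDeriv_coeff, ad_coeff, map_zsmul, smul_sub]

theorem ad_shift (T T' : Module.End ℂ (Fock l)) (n : ℤ) (A : FockField l) :
    ad T T' (shift n A) = shift n (ad T T' A) := by
  refine field_ext fun v t => ?_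
  simp only [shift_coeff, ad_coeff]

theorem ad_mode_ad_transl (γ β : Fin l → ℂ) (i : Fin l) (n : ℤ) (A : FockField l) :
    ad (mode γ i n) (mode β i n) (ad (transl γ) (transl β) A) =
      ad (transl γ) (transl β) (ad (mode γ i n) (mode β i n) A) +
        n • ad (mode γ i (n - 1)) (mode β i (n - 1)) A := by
  refine field_ext fun v t => ?_
  simp only [ad_coeff, LinearMap.add_apply, HahnSeries.coeff_add, LinearMap.smul_apply,
    HahnSeries.coeff_smul, map_sub, mode_transl, map_add, map_zsmul, smul_sub]
  abel

theorem minusSeries_coeff_add_one (α : Fin l → ℂ) (n : ℕ) :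
    ((n : ℤ) + 1) • (minusSeries α).coeff (n + 1) = (n + 1) • minusCoeff α (n + 1) 1 := by
  have := minusSeries_coeff_natCast α (n + 1)
  push_cast at this
  rw [this]
  exact_mod_cast natCast_zsmul (minusCoeff α (n + 1) 1) (n + 1)

theorem add_one_smul_minusSeries_coeff_of_neg (α : Fin l → ℂ) {t : ℤ} (ht : t < 0) :
    (t + 1) • (minusSeries α).coeff (t + 1) = 0 := by
  rcases eq_or_lt_of_le (show t + 1 ≤ 0 by omega) with h | h
  · rw [h, zero_smul]
  · rw [minusSeries_coeff_of_neg α h, smul_zero]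

/-- The difference of the sides is covariant, since both produce the extra term $n\alpha^iz^{n-1}E$;
on $\mathbf 1$ the claim is `transl_minusCoeff`. -/
theorem ad_transl_expField (α : Fin l → ℂ) :
    ad (transl α) (transl 0) (expField α) = fieldDeriv (expField α) := by
  rw [← sub_eq_zero]
  refine field_eq_zero (α := α) ?_ fun i n => ?_
  · refine HahnSeries.ext (funext fun t => ?_)
    rw [LinearMap.sub_apply, HahnSeries.coeff_sub, ad_coeff, fieldDeriv_coeff, transl_zero_one,
      map_zero, expField_one_coeff, expField_one_coeff]
    rcases lt_or_ge t 0 with ht | ht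
    · rw [add_one_smul_minusSeries_coeff_of_neg α ht, minusSeries_coeff_of_neg α ht]
      simp
    · lift t to ℕ using ht
      rw [minusSeries_coeff_natCast, transl_minusCoeff, minusSeries_coeff_add_one]
      simp
  · rw [map_sub, ad_mode_ad_transl, ad_fieldDeriv, ad_mode_expField, ad_mode_expField, map_smul,
      map_smul, fieldDeriv_shift, ad_shift, map_sub, smul_sub, smul_add, smul_comm n]
    abel

/-- On $\mathbf 1$ this is the Euler recursion for $Y_-\mathbf 1$. Off the vacuum, the contraction
of $a^i(n)$ with $\alpha(z)$ matches the derivative of $z^n$. -/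
theorem fieldDeriv_expField (α : Fin l → ℂ) :
    fieldDeriv (expField α) = ∑ j, α j • normalMul 0 (j, 0) (expField α) := by
  rw [← sub_eq_zero]
  refine field_eq_zero (α := α) ?_ fun i n => ?_
  · refine HahnSeries.ext (funext fun t => ?_)
    rw [LinearMap.sub_apply, HahnSeries.coeff_sub, fieldDeriv_coeff, LinearMap.sum_apply,
      HahnSeries.coeff_sum, expField_one_coeff]
    rcases lt_or_ge t 0 with ht | ht
    · rw [add_one_smul_minusSeries_coeff_of_neg α ht, sum_eq_zero]
      · simp
      · intro j _
        rw [LinearMap.smul_apply, HahnSeries.coeff_smul, normalMul_coeff 0 (j, 0) _ 1 t (J := 0)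
          (N := 0) (fun k _ => by
            rw [expField_one_coeff, minusSeries_coeff_of_neg α (by omega)])
          fun n _ => mode_one j (by omega)]
        simp
    · lift t to ℕ using ht
      rw [minusSeries_coeff_add_one, succ_smul_minusCoeff, sum_comm, ← sum_sub_distrib]
      refine sum_eq_zero fun j _ => ?_
      rw [LinearMap.smul_apply, HahnSeries.coeff_smul, normalMul_coeff 0 (j, 0) _ 1 t (J := t + 1)
          (N := 0) (fun k hk => by
            rw [expField_one_coeff, minusSeries_coeff_of_neg α (by omega)])
          fun n _ => mode_one j (by omega), ← smul_sum, ← smul_sub,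
        Nat.sum_antidiagonal_eq_sum_range_succ_mk, sum_range_zero, add_zero, ← sum_sub_distrib,
        sum_eq_zero, smul_zero]
      intro k hk
      rw [expField_one_coeff, ← Nat.cast_sub (by have := mem_range.1 hk; omega),
        minusSeries_coeff_natCast]
      simp
  · rw [map_sub, ad_fieldDeriv, ad_mode_expField, map_smul, map_sum, fieldDeriv_shift, map_sub,
      map_sum, smul_sub, smul_add, smul_sum]
    have h : ∀ j, ad (mode α i n) (mode 0 i n) (α j • normalMul 0 (j, 0) (expField α)) =
        (if i = j then α j • n • shift (n - 1) (expField α) else 0) +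
          α i • shift n (α j • normalMul 0 (j, 0) (expField α)) := by
      intro j
      rw [map_smul, ad_mode_normalMul, ad_mode_expField, ← normalMulHom_apply, map_smul,
        normalMulHom_apply, normalMul_shift, smul_add, map_smul, smul_comm (α i)]
      congr 1
      by_cases hij : i = j <;> simp [hij]
    rw [sum_congr rfl fun j _ => h j, sum_add_distrib]
    simp only [sum_ite_eq, mem_univ, if_true]
    abel

theorem fieldOf_expField_transl_one (α : Fin l → ℂ) :
    fieldOf 0 (expField α) (transl α 1) = fieldDeriv (expField α) := by
  rw [transl_one, map_sum, fieldDeriv_expField]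
  refine sum_congr rfl fun j _ => ?_
  rw [map_smul, ← mul_one (MvPolynomial.X (j, 0)), fieldOf_X_mul, fieldOf_one]

/-! ### Existence -/

theorem expField_creative (α : Fin l → ℂ) (w : Fock l) :
    (fieldOf 0 (expField α) w 1).coeff 0 = w ∧
      ∀ t : ℤ, t < 0 → (fieldOf 0 (expField α) w 1).coeff t = 0 := by
  refine fieldOf_creative ?_ (fun t ht => ?_) w
  · rw [expField_one_coeff]
    simpa [minusCoeff_zero] using minusSeries_coeff_natCast α 0
  · rw [expField_one_coeff, minusSeries_coeff_of_neg α ht]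

theorem idField_creative (w : Fock l) :
    (fieldOf 0 idField w 1).coeff 0 = w ∧
      ∀ t : ℤ, t < 0 → (fieldOf 0 idField w 1).coeff t = 0 := by
  refine fieldOf_creative (by simp [idField_coeff]) (fun t ht => ?_) w
  rw [idField_coeff, if_neg ht.ne]

theorem freelyGenerated (α : Fin l → ℂ) :
    FreelyGenerated (mode 0) (mode α) (1 : Fock l) (transl 0) (transl α) (vertexModes 0)
      (vertexModes α) (modesOf (fieldOf 0 (expField α))) where
  covY := modesOf_covariant (ad_mode_idField 0)
  covYW := modesOf_covariant (ad_mode_idField α)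
  covI := modesOf_covariant (ad_mode_expField α)
  truncY := modesOf_truncated _
  truncYW := modesOf_truncated _
  truncI := modesOf_truncated _
  truncV := eventually_mode_eq_zero 0
  truncW := eventually_mode_eq_zero α
  creatY u := (idField_creative u).1
  creatY_nonneg u n hn := (idField_creative u).2 _ (by omega)
  creatI w := (expField_creative α w).1
  creatI_nonneg w n hn := (expField_creative α w).2 _ (by omega)
  transl_vac := transl_zero_one
  translY := modesOf_translation (ad_transl_idField 0)
  translYW := modesOf_translation (ad_transl_idField α)
  translI := modesOf_translation (ad_transl_expField α)
  transl_mode := mode_transl α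
  YW_vac := vertexModes_one α
  normal i s u n w J K hJ hK := by
    rw [mode_neg_succ, vertexModes_eq, modesOf_X_mul α idField i s u n w J K hJ hK]
    congr 1
    refine sum_congr rfl fun m _ => ?_
    rw [show -(m : ℤ) - s - 1 = -((m + s : ℕ) : ℤ) - 1 by push_cast; ring, mode_neg_succ]
  generated P h1 h2 h3 h4 u :=
    fock_induction h1 h2 h3 (fun x u hu => by
      have := h4 x.1 x.2 u hu
      rwa [mode_neg_succ] at this) u

theorem isCreativeIntertwiner (α : Fin l → ℂ) :
    IsCreativeIntertwiner (vertexModes 0) (1 : Fock l) (conformal l) (vertexModes α)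
      (modesOf (fieldOf 0 (expField α))) where
  creative w := ⟨(freelyGenerated α).creatI w, (freelyGenerated α).creatI_nonneg w⟩
  truncated := modesOf_truncated _
  translation := modesOf_transl (fieldOf_expField_transl_one α)
  jacobi u w v p q r := by
    have h := (freelyGenerated α).jacobiDefect_eq_zero u w v p q r
    rw [jacobiDefect, sub_eq_zero] at h
    simp only [Ring.neg_one_pow_mul_choose]
    exact h

/-! ### Uniqueness -/

theorem modeCovariant_of_isCreativeIntertwiner {α : Fin l → ℂ}
    {I : Fock l →ₗ[ℂ] (ℤ → (Fock l →ₗ[ℂ] Fock l))}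
    (h : IsCreativeIntertwiner (vertexModes 0) (1 : Fock l) (conformal l) (vertexModes α) I) :
    ModeCovariant (mode α) (mode 0) (mode α) I := by
  intro i n m w v K hK
  -- At `r = 0` both left-hand sums collapse to their $j=0$ term, and the identity becomes the
  -- commutator formula.
  have hj := h.jacobi (MvPolynomial.X (i, 0)) w v n m 0
  simp only [Ring.neg_one_pow_mul_choose, vertexModes_X, zero_add] at hj
  rw [finsum_eq_sum_range (N := 1) fun j hj => by
      rw [Ring.choose_zero_pos ℤ (by omega), mul_zero, zero_smul],
    finsum_eq_sum_range (N := 1) fun j hj => by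
      rw [Ring.choose_zero_pos ℤ (by omega), mul_zero, zero_smul],
    finsum_eq_sum_range (N := K) fun j hj => by rw [hK j hj, map_zero]; simp,
    sum_range_one, sum_range_one, sub_eq_iff_eq_add'] at hj
  simpa using hj

/-- The translation axiom expresses $w(-2-k)\mathbf 1$ through $(L(-1)w)(-1-k)\mathbf 1$, with
nonzero factor $k+1$; creativity starts the induction. -/
theorem creative_apply_one {α : Fin l → ℂ} {I I' : Fock l →ₗ[ℂ] (ℤ → (Fock l →ₗ[ℂ] Fock l))}
    (h : IsCreativeIntertwiner (vertexModes 0) (1 : Fock l) (conformal l) (vertexModes α) I)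
    (h' : IsCreativeIntertwiner (vertexModes 0) (1 : Fock l) (conformal l) (vertexModes α) I')
    (w : Fock l) (n : ℤ) : I w n 1 = I' w n 1 := by
  rcases le_or_gt 0 n with hn | hn
  · rw [(h.creative w).2 n hn, (h'.creative w).2 n hn]
  obtain ⟨k, rfl⟩ : ∃ k : ℕ, n = -1 - k := ⟨(-1 - n).toNat, by omega⟩
  clear hn
  induction k generalizing w with
  | zero => simpa using (h.creative w).1.trans (h'.creative w).1.symm
  | succ k ih =>
    have h1 := LinearMap.congr_fun (h.translation w (-1 - k)) 1
    have h2 := LinearMap.congr_fun (h'.translation w (-1 - k)) 1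
    rw [ih, h2, LinearMap.smul_apply, LinearMap.smul_apply, ← sub_eq_zero, ← smul_sub] at h1
    have h3 := sub_eq_zero.1 (FreelyGenerated.eq_zero_of_zsmul (by omega) h1)
    rw [show -1 - ((k + 1 : ℕ) : ℤ) = -1 - (k : ℤ) - 1 by push_cast; ring]
    exact h3.symm

theorem creativeIntertwiner_unique {α : Fin l → ℂ}
    {I I' : Fock l →ₗ[ℂ] (ℤ → (Fock l →ₗ[ℂ] Fock l))}
    (h : IsCreativeIntertwiner (vertexModes 0) (1 : Fock l) (conformal l) (vertexModes α) I)
    (h' : IsCreativeIntertwiner (vertexModes 0) (1 : Fock l) (conformal l) (vertexModes α) I') :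
    I = I' := by
  suffices H : ∀ v w n, I w n v = I' w n v from
    LinearMap.ext fun w => funext fun n => LinearMap.ext fun v => H v w n
  intro v
  induction v using fock_induction with
  | one => exact creative_apply_one h h'
  | add u v hu hv => intro w n; rw [map_add, map_add, hu, hv]
  | smul c u hu => intro w n; rw [map_smul, map_smul, hu]
  | X_mul x u hu =>
    intro w n
    obtain ⟨K, hK⟩ := (eventually_mode_eq_zero α x.1 w).exists_forall_of_atTop
    have h1 := modeCovariant_of_isCreativeIntertwiner h x.1 (-(x.2 : ℤ) - 1) n w u K hK
    have h2 := modeCovariant_of_isCreativeIntertwiner h' x.1 (-(x.2 : ℤ) - 1) n w u K hK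
    simp only [hu] at h1
    rw [h1, mode_neg_succ] at h2
    exact add_right_cancel h2

/-! ### The explicit formula -/

theorem dressedCoeff_eq (α : Fin l → ℂ) (u : Fock l) (t : ℤ) (v : Fock l) :
    dressedCoeff α u t v = (fieldOf 0 (expField α) u v).coeff t := by
  obtain ⟨P, hP⟩ := (eventually_plusCoeff_eq_zero α v).exists_forall_of_atTop
  -- Only the finitely many $p<P$ matter, so one `J` bounds all exponents from $Y_-$ and the support
  -- lies in a rectangle.
  obtain ⟨J, hJ⟩ := ((eventually_all_finset (range P)).2 fun p _ => eventually_coeff_eq_zero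
    (fieldOf 0 idField u (plusCoeff α p v)) (t + p)).exists_forall_of_atTop
  rw [← dress_fieldOf, dress_eq_sum α _ v hP, mul_sum, HahnSeries.coeff_sum, dressedCoeff,
    finsum_eq_sum_of_support_subset (s := range J ×ˢ range P), sum_product_right]
  · refine sum_congr rfl fun p hp => ?_
    rw [mul_left_comm, HahnSeries.coeff_single_mul, one_mul, sub_neg_eq_add, minusSeries,
      ofPowerSeries_mul_coeff fun j hj => hJ j hj p hp]
    refine sum_congr rfl fun m _ => ?_
    rw [← minusCoeff_apply, vertexField_eq, show t - (m : ℤ) + p = t + p - m by ring]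
  · rintro ⟨m, p⟩ h
    rw [Function.mem_support] at h
    simp only [coe_product, coe_range, Set.mem_prod, Set.mem_Iio]
    by_contra hmp
    apply h
    by_cases hp : p < P
    · have := hJ m (by omega) p (mem_range.2 hp)
      rw [vertexField_eq, show t - (m : ℤ) + p = t + p - m by ring, this, map_zero]
    · rw [show PowerSeries.coeff p (expPlus 0 α) v = 0 from hP p (by omega), map_zero,
        HahnSeries.coeff_zero, map_zero]

theorem modeSeries_eq_explicitSeries (α : Fin l → ℂ) (u v : Fock l) :
    modeSeries (fun n => modesOf (fieldOf 0 (expField α)) u n v) =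
      explicitSeries α LinearMap.id u v := by
  funext s
  have h1 : explicitSeries α LinearMap.id u v s =
      ∑ᶠ (t : ℤ) (_ : (t : ℂ) = s), dressedCoeff α u t v := by
    rw [explicitSeries, zPow, Finsupp.lsingle_apply, Finsupp.sum_single_index]
    · simp [expQ]
    · refine finsum_eq_zero_of_forall_eq_zero fun t => ?_
      simp [dressedCoeff]
  rw [h1, modeSeries]
  -- As $\alpha(0)=0$ on $M^l$, only integer exponents occur; $z^t$ corresponds to the mode
  -- $n=-t-1$.
  by_cases hs : ∃ t : ℤ, (t : ℂ) = s
  · obtain ⟨t, rfl⟩ := hs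
    rw [finsum_eq_single _ (-t - 1), finsum_eq_single _ t, finsum_eq_if, finsum_eq_if,
      if_pos rfl, if_pos (by push_cast; ring), dressedCoeff_eq, modesOf_apply,
      show -(-t - 1) - 1 = t by ring]
    · intro n hn
      rw [finsum_eq_if, if_neg (by exact_mod_cast hn)]
    · intro n hn
      rw [finsum_eq_if, if_neg]
      intro h
      have : t = -n - 1 := by exact_mod_cast h
      omega
  · rw [finsum_eq_zero_of_forall_eq_zero, finsum_eq_zero_of_forall_eq_zero]
    · intro t
      rw [finsum_eq_if, if_neg fun h => hs ⟨t, h⟩]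
    · intro n
      rw [finsum_eq_if, if_neg fun h => hs ⟨-n - 1, by push_cast; exact h.symm⟩]

end

end Heisenberg

theorem theorem3 (l : ℕ) (α : Fin l → ℂ) :
    ∃ 𝒴 : Heisenberg.FockModule α →ₗ[ℂ] (ℤ → (Heisenberg.Fock l →ₗ[ℂ] Heisenberg.FockModule α)),
      IsCreativeIntertwiner (Heisenberg.vertexModes 0) (1 : Heisenberg.Fock l)
        (Heisenberg.conformal l) (Heisenberg.vertexModes α) 𝒴 ∧
      (∀ 𝒴' : Heisenberg.FockModule α →ₗ[ℂ] (ℤ → (Heisenberg.Fock l →ₗ[ℂ] Heisenberg.FockModule α)),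
        IsCreativeIntertwiner (Heisenberg.vertexModes 0) (1 : Heisenberg.Fock l)
          (Heisenberg.conformal l) (Heisenberg.vertexModes α) 𝒴' → 𝒴' = 𝒴) ∧
      ∀ u v : Heisenberg.Fock l,
        modeSeries (fun n => 𝒴 (Heisenberg.expQ α u) n v) =
          Heisenberg.explicitSeries α LinearMap.id u v :=
  ⟨Heisenberg.modesOf (Heisenberg.fieldOf 0 (Heisenberg.expField α)),
    Heisenberg.isCreativeIntertwiner α,
    fun _ h => Heisenberg.creativeIntertwiner_unique h (Heisenberg.isCreativeIntertwiner α),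
    Heisenberg.modeSeries_eq_explicitSeries α⟩
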